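/- **Definitions.** Let $[a,b]$ be a compact interval, $a<b$, in $\mathbb R$ or in the extended real line $[-\infty,\infty]$. A continuous map $f:[a,b]\to[a,b]$ is *countably piecewise monotone and Markov* with respect to $P\subset[a,b]$ if $P$ is closed and countable, $a,b\in P$, $f(P)\subset P$, and $f$ is monotone on every component of $[a,b]\setminus P$ (these components are the *basic intervals*). It has *constant slope* $\lambda$ if, for some such $P$, it is affine with slope of absolute value $\lambda$ on each basic interval. The *transition matrix* $T$ of $(f,P)$ is indexed by the basic intervals: $T_{IJ}=1$ if $f(I)\supseteq J$ and $T_{IJ}=0$ otherwise. A *nonnegative eigenvector* with eigenvalue $\lambda\in\mathbb R$ is a nonzero vector $v\ge 0$ with $\sum_J T_{IJ}v_J=\lambda v_I$ (a convergent sum) for all $I$. For a vertex $u$ of the transition graph of $T$ let $p^{(n)}_{uu}$ be the number of loops of length $n$ at $u$, and $f^{(n)}_{uu}$ the number of those that do not visit $u$ at an intermediate time. The chain has *Perron value* $\lambda_M$ if $\lim_n (p^{(n)}_{uu})^{1/n}=\lambda_M$ for every $u$; a transitive chain with Perron value $\lambda_M$ is *strongly positive recurrent* if $\limsup_n (f^{(n)}_{uu})^{1/n}<\lambda_M$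 for some $u$. **Statement.** The polynomial $\lambda^3-2\lambda^2-\lambda-2$ has exactly one real root $\lambda_{\min}$. There is a topologically mixing continuous map $f:[0,1]\to[0,1]$, countably piecewise monotone and Markov with respect to a set $P$, of the following form. Its basic intervals are $A_i,B_i,C_i$ $(i\ge 0)$ and $D$, ordered from left to right as $$D<C_0<C_1<C_2<\cdots<B_2<A_2<B_1<A_1<B_0<A_0 ,$$ of lengths proportional, with total length $1$, to $$|A_i|:\ (\lambda_{\min}^2+1)\lambda_{\min}^{-i},\quad |B_i|:\ (\lambda_{\min}^2-1)\lambda_{\min}^{-i},\quad |C_i|:\ (\lambda_{\min}^3-\lambda_{\min}^2-\lambda_{\min}-1)\lambda_{\min}^{-i},\quad |D|:\ (\lambda_{\min}^3-\lambda_{\min}^2-\lambda_{\min}-1)\lambda_{\min};$$ $f$ is affine with slope $+\lambda_{\min}$ on each $A_i$ and $C_i$, and with slope $-\lambda_{\min}$ on each $B_i$ and on $D$; and the basic intervals covered by the images are: by $f(D)$ all of them; by $f(C_0)$ only $D$; by $f(C_i)$, $i\ge1$, only $C_{i-1}$; by $f(A_i)$ the $A_j,B_j$ with $j\ge i+1$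 and the $C_j$ with $j\ge i$; by $f(B_i)$ the $A_j,B_j$ with $j\ge i+2$ and the $C_j$ with $j\ge i$. For this $f$, with transition matrix $T$ of $(f,P)$: 1. Every nonnegative eigenvector of $T$ has a finite sum of entries, and for real $\lambda$ a nonnegative eigenvector of $T$ with eigenvalue $\lambda$ exists if and only if $\lambda\ge\lambda_{\min}$. 2. For every $\lambda\ge\lambda_{\min}$, $f$ is topologically conjugate to a continuous countably piecewise monotone Markov map $g:[0,1]\to[0,1]$ of constant slope $\lambda$. 3. $f$ is not topologically conjugate to any continuous countably piecewise monotone Markov map of constant slope (whatever the slope) on the extended real line $[-\infty,\infty]$ or on an extended half-line $[a,\infty]$ or $[-\infty,b]$. 4. The topological entropy of $f$ is $h_{\mathrm{top}}(f)=\log\lambda_{\min}$. 5. The Markov chain of $T$ has Perron value $\lambda_{\min}$ and is strongly positive recurrent. -/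

import Mathlib

open Set Filter Topology
open scoped ENNReal

/-! ### Countably piecewise monotone Markov maps -/

/-- The `P`-basic intervals: the connected components of the complement of `P`. -/
def IsBasicInterval {X : Type*} [TopologicalSpace X] (P J : Set X) : Prop :=
  ∃ x ∈ Pᶜ, J = connectedComponentIn Pᶜ x

/-- The type of all `P`-basic intervals. -/
def BasicInterval {X : Type*} [TopologicalSpace X] (P : Set X) : Type _ :=
  {J : Set X // IsBasicInterval P J}

/-- `f` is a continuous self-map of the nondegenerate closed interval `[a, b]` (of the real line,
or of the extended real line) which is countably piecewise monotone and Markov with respect to the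
partition set `P`. -/
structure IsCPMM {E : Type*} [LinearOrder E] [TopologicalSpace E] {a b : E}
    (f : Icc a b → Icc a b) (P : Set (Icc a b)) : Prop where
  lt : a < b
  continuous : Continuous f
  isClosed : IsClosed P
  countable : P.Countable
  left_mem : ∀ x : Icc a b, (x : E) = a → x ∈ P
  right_mem : ∀ x : Icc a b, (x : E) = b → x ∈ P
  mapsTo : MapsTo f P P
  monotone : ∀ J, IsBasicInterval P J → MonotoneOn f J ∨ AntitoneOn f J

/-- On every `P`-basic interval the map `f` of the real interval `[a, b]` is affine with slope of
absolute value `l`. -/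
def HasConstantSlope {a b : ℝ} (f : Icc a b → Icc a b) (P : Set (Icc a b)) (l : ℝ) : Prop :=
  ∀ J, IsBasicInterval P J →
    ∃ s c : ℝ, |s| = l ∧ ∀ x ∈ J, (f x : ℝ) = s * (x : ℝ) + c

/-- The same for a map of an interval `[a, b]` of the extended real line. When `a, b ∈ P`, all
points of a `P`-basic interval are finite, i.e. of the form `t : ℝ`. -/
def HasConstantSlopeExt {a b : EReal} (f : Icc a b → Icc a b) (P : Set (Icc a b)) (l : ℝ) : Prop :=
  ∀ J, IsBasicInterval P J →
    ∃ s c : ℝ, |s| = l ∧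
      ∀ x ∈ J, ∀ t : ℝ, (x : EReal) = (t : EReal) → (f x : EReal) = ((s * t + c : ℝ) : EReal)

/-- Topological mixing. -/
def IsTopMixing {X : Type*} [TopologicalSpace X] (f : X → X) : Prop :=
  ∀ U V : Set X, IsOpen U → IsOpen V → U.Nonempty → V.Nonempty →
    ∃ n₀ : ℕ, ∀ n ≥ n₀, (f^[n] '' U ∩ V).Nonempty

/-- Topological conjugacy. -/
def IsConjugateTo {X Y : Type*} [TopologicalSpace X] [TopologicalSpace Y]
    (f : X → X) (g : Y → Y) : Prop :=
  ∃ ψ : X ≃ₜ Y, ∀ x, ψ (f x) = g (ψ x)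

/-! ### The transition matrix and its Markov chain -/

open Classical in
/-- The transition matrix: `T I J = 1` if `f(I) ⊇ J`, and `T I J = 0` otherwise. -/
noncomputable def transitionMatrix {X : Type*} [TopologicalSpace X] (f : X → X) (P : Set X) :
    Matrix (BasicInterval P) (BasicInterval P) ℝ :=
  fun I J => if J.1 ⊆ f '' I.1 then 1 else 0

/-- `v` is a nonnegative (nonzero) eigenvector of `T` with eigenvalue `l`. -/
def IsNonnegEigenvector {V : Type*} (T : Matrix V V ℝ) (l : ℝ) (v : V → ℝ) : Prop :=
  (∀ I, 0 ≤ v I) ∧ v ≠ 0 ∧ ∀ I, HasSum (fun J => T I J * v J) (l * v I)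

/-- The paths of length `n` from `u` to `w` in the transition graph of the 0-1 matrix `T`. -/
def pathSet {V : Type*} (T : Matrix V V ℝ) (n : ℕ) (u w : V) : Set (Fin (n + 1) → V) :=
  {p | p 0 = u ∧ p (Fin.last n) = w ∧ ∀ i : Fin n, T (p i.castSucc) (p i.succ) = 1}

/-- The number of loops of length `n` that start and end at `u`. -/
noncomputable def loopCount {V : Type*} (T : Matrix V V ℝ) (u : V) (n : ℕ) : ℕ∞ :=
  (pathSet T n u u).encard

/-- The number of those loops of length `n` at `u` that do not visit `u` at any intermediate
time. -/
noncomputable def firstReturnCount {V : Type*} (T : Matrix V V ℝ) (u : V) (n : ℕ) : ℕ∞ :=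
  {p ∈ pathSet T n u u | ∀ i : Fin (n + 1), i ≠ 0 → i ≠ Fin.last n → p i ≠ u}.encard

/-- The chain has Perron value `L`: the numbers of loops satisfy `(p_uu^(n))^(1/n) → L`, for every
vertex `u`. -/
def HasPerronValue {V : Type*} (T : Matrix V V ℝ) (L : ℝ≥0∞) : Prop :=
  ∀ u, Tendsto (fun n : ℕ => (loopCount T u n : ℝ≥0∞) ^ (1 / (n : ℝ))) atTop (𝓝 L)

/-- The exponential growth rate of the numbers of first return loops at `u`. -/
noncomputable def firstReturnRate {V : Type*} (T : Matrix V V ℝ) (u : V) : ℝ≥0∞ :=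
  limsup (fun n : ℕ => (firstReturnCount T u n : ℝ≥0∞) ^ (1 / (n : ℝ))) atTop

/-- Every vertex can be reached from every vertex. -/
def IsTransitiveChain {V : Type*} (T : Matrix V V ℝ) : Prop :=
  ∀ u w, ∃ n, 1 ≤ n ∧ (pathSet T n u w).Nonempty

/-- Strong positive recurrence of a transitive chain: for some vertex the first return loops grow
at a strictly smaller exponential rate than all loops do. -/
def IsStronglyPositiveRecurrent {V : Type*} (T : Matrix V V ℝ) : Prop :=
  IsTransitiveChain T ∧ ∃ L : ℝ≥0∞, HasPerronValue T L ∧ ∃ u, firstReturnRate T u < L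

/-! ### The combinatorics and the geometry of the example -/

/-- Names for the basic intervals of the example. -/
inductive Cell : Type
  | A (i : ℕ) : Cell
  | B (i : ℕ) : Cell
  | C (i : ℕ) : Cell
  | D : Cell

/-- The order of the intervals from left to right:
`D < C₀ < C₁ < C₂ < ⋯ < B₂ < A₂ < B₁ < A₁ < B₀ < A₀`. -/
def Cell.LeftOf : Cell → Cell → Prop
  | .D, .D => False
  | .D, _ => True
  | .C _, .D => False
  | .C i, .C j => i < j
  | .C _, .A _ => True
  | .C _, .B _ => True
  | .A i, .A j => j < i
  | .A i, .B j => j < i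
  | .B i, .A j => j ≤ i
  | .B i, .B j => j < i
  | .A _, .C _ => False
  | .A _, .D => False
  | .B _, .C _ => False
  | .B _, .D => False

/-- The Markov dynamics: `Cell.Covers X Y` says that the image of `X` covers `Y`. -/
def Cell.Covers : Cell → Cell → Prop
  | .D, _ => True
  | .C 0, Y => Y = .D
  | .C (i + 1), Y => Y = .C i
  | .A i, .A j => i + 1 ≤ j
  | .A i, .B j => i + 1 ≤ j
  | .A i, .C j => i ≤ j
  | .A _, .D => False
  | .B i, .A j => i + 2 ≤ j
  | .B i, .B j => i + 2 ≤ j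
  | .B i, .C j => i ≤ j
  | .B _, .D => False

/-- The lengths of the intervals up to a common factor; their sum is
`l ^ 2 * (l ^ 3 - l ^ 2 - l - 1)` when `l ^ 3 - 2 * l ^ 2 - l - 2 = 0`. -/
noncomputable def Cell.weight (l : ℝ) : Cell → ℝ
  | .A i => (l ^ 2 + 1) / l ^ i
  | .B i => (l ^ 2 - 1) / l ^ i
  | .C i => (l ^ 3 - l ^ 2 - l - 1) / l ^ i
  | .D => (l ^ 3 - l ^ 2 - l - 1) * l

/-- `f` is the map of the example on `[0, 1]`: its `P`-basic intervals are `K X`, `X : Cell`, in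
the prescribed order and with the prescribed lengths (scaled to total length one), `f` follows the
prescribed Markov dynamics, increases on the intervals `A`, `C`, decreases on the intervals
`B`, `D`, and is affine with slope `± l` on each of them. -/
structure IsExampleMap (l : ℝ) (f : Icc (0 : ℝ) 1 → Icc (0 : ℝ) 1) (P : Set (Icc (0 : ℝ) 1))
    (K : Cell → Set (Icc (0 : ℝ) 1)) : Prop where
  isCPMM : IsCPMM f P
  basic : ∀ J, IsBasicInterval P J ↔ ∃ X, J = K X
  order : ∀ X Y, X.LeftOf Y → ∀ x ∈ K X, ∀ y ∈ K Y, x < y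
  length : ∀ X, Metric.diam (K X) = X.weight l / (l ^ 2 * (l ^ 3 - l ^ 2 - l - 1))
  covers : ∀ X Y, K Y ⊆ f '' K X ↔ X.Covers Y
  strictMono_A : ∀ i, StrictMonoOn f (K (.A i))
  strictMono_C : ∀ i, StrictMonoOn f (K (.C i))
  strictAnti_B : ∀ i, StrictAntiOn f (K (.B i))
  strictAnti_D : StrictAntiOn f (K .D)
  slope : HasConstantSlope f P l

/-!
The combinatorics of the example is a Markov scheme: the ordered set of partition points together
with the action of the map on it. A monotone placement of these points in `[0, 1]` for which every
gap is stretched by the same factor `l` extends to a map of constant slope `l`, and the lengths of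
its gaps form an eigenvector with eigenvalue `l`. For this scheme such placements can be written
down explicitly whenever `cubic l ≥ 0`. As transitions between cells are realised by points, all
these maps are conjugate.

At the root of the cubic the cells other than `D` are so short that the lengths are dominated by
multiples of a positive vector which the matrix with the vertex `D` deleted maps below its double.
Hence paths that avoid `D` grow at most like `2 ^ n`, whereas `2 < l`; this yields strong positive
recurrence, and comparison with the eigenvector then shows that the number of loops at `D` is
comparable to `l ^ n`. The Perron value, the entropy and the lower bound for the eigenvalues follow.

On an interval of infinite length, a conjugate map of constant slope would send the cell `C 0`,
which is bounded because it stays away from the endpoints, onto a bounded set containing `D`, and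
then `D` onto a bounded set; but the image of `D` is the whole interior.
-/

section ExtendedLine

lemma abs_sub_le_of_hasDerivAt_off_countable {h : ℝ → ℝ} {u v l : ℝ} (huv : u ≤ v) {S : Set ℝ}
    (hS : S.Countable) (hc : ContinuousOn h (Icc u v))
    (hd : ∀ t ∈ Ioo u v \ S, ∃ s, |s| ≤ l ∧ HasDerivAt h s t) :
    |h v - h u| ≤ l * |v - u| := by
  have hderiv : ∀ t ∈ Ioo u v \ S, |deriv h t| ≤ l ∧ HasDerivAt h (deriv h t) t := by
    intro t ht
    obtain ⟨s, hs, hst⟩ := hd t ht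
    exact hst.deriv.symm ▸ ⟨hs, hst⟩
  have hbound : ∀ᵐ t, t ∈ uIoc u v → ‖deriv h t‖ ≤ l := by
    filter_upwards [(hS.union (countable_singleton v)).ae_notMem MeasureTheory.volume] with t ht htu
    rw [uIoc_of_le huv] at htu
    rw [mem_union, mem_singleton_iff, not_or] at ht
    exact (hderiv t ⟨⟨htu.1, lt_of_le_of_ne htu.2 ht.2⟩, ht.1⟩).1
  have hint : IntervalIntegrable (deriv h) MeasureTheory.volume u v := by
    refine (intervalIntegrable_const (c := l)).mono_fun
      (measurable_deriv h).aestronglyMeasurable ?_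
    rw [Filter.EventuallyLE, MeasureTheory.ae_restrict_iff' measurableSet_uIoc]
    filter_upwards [hbound] with t ht htu
    exact (ht htu).trans (le_abs_self l)
  rw [← MeasureTheory.integral_eq_of_hasDerivAt_off_countable_of_le h (deriv h) huv hS hc
    (fun t ht => (hderiv t ht).2) hint]
  exact intervalIntegral.norm_integral_le_of_norm_le_const_ae hbound

variable {a b : EReal} {g : Icc a b → Icc a b} {Q : Set (Icc a b)} {l : ℝ}

lemma coe_projIcc_of_mem {t : ℝ} (hab : a ≤ b) (ht : (t : EReal) ∈ Icc a b) :
    (projIcc a b hab t : EReal) = t :=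
  congrArg Subtype.val (projIcc_of_mem hab ht)

lemma continuous_projIcc_coe (hab : a ≤ b) : Continuous fun t : ℝ => projIcc a b hab t :=
  continuous_projIcc.comp continuous_coe_real_ereal

lemma exists_hasDerivAt_toReal_projIcc (hg : IsCPMM g Q) (hl : HasConstantSlopeExt g Q l) {t : ℝ}
    (ht : (t : EReal) ∈ Ioo a b) (htQ : projIcc a b hg.lt.le t ∉ Q) :
    ∃ s, |s| = l ∧ HasDerivAt (fun x : ℝ => (g (projIcc a b hg.lt.le x) : EReal).toReal) s t := by
  set e : ℝ → Icc a b := fun x => projIcc a b hg.lt.le x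
  have he : Continuous e := continuous_projIcc_coe hg.lt.le
  obtain ⟨s, c, hs, hsc⟩ := hl _ ⟨e t, htQ, rfl⟩
  have haffine : HasDerivAt (fun x : ℝ => s * x + c) s t := by
    simpa using ((hasDerivAt_id t).const_mul s).add_const c
  refine ⟨s, hs, haffine.congr_of_eventuallyEq ?_⟩
  have hopen : IsOpen ((fun x : ℝ => (x : EReal)) ⁻¹' Ioo a b ∩ e ⁻¹' Qᶜ) :=
    (isOpen_Ioo.preimage continuous_coe_real_ereal).inter (hg.isClosed.isOpen_compl.preimage he)
  obtain ⟨r, hr, hball⟩ := Metric.isOpen_iff.1 hopen t ⟨ht, htQ⟩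
  have hcomp : e '' Metric.ball t r ⊆ connectedComponentIn Qᶜ (e t) :=
    IsPreconnected.subset_connectedComponentIn
      ((convex_ball t r).isPreconnected.image e he.continuousOn)
      (mem_image_of_mem e (Metric.mem_ball_self hr))
      (image_subset_iff.2 fun x hx => (hball hx).2)
  filter_upwards [Metric.ball_mem_nhds t hr] with x hx
  rw [hsc (e x) (hcomp (mem_image_of_mem e hx)) x
    (coe_projIcc_of_mem hg.lt.le (Ioo_subset_Icc_self (hball hx).1)), EReal.toReal_coe]

lemma abs_toReal_projIcc_sub_le (hg : IsCPMM g Q) (hl : HasConstantSlopeExt g Q l) {u v : ℝ}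
    (huv : u ≤ v) (hau : a ≤ u) (hvb : v ≤ b)
    (hfin : ∀ t ∈ Icc u v, (g (projIcc a b hg.lt.le t) : EReal) ∈ ({⊥, ⊤}ᶜ : Set EReal)) :
    |(g (projIcc a b hg.lt.le v) : EReal).toReal - (g (projIcc a b hg.lt.le u) : EReal).toReal| ≤
      l * |v - u| := by
  set e : ℝ → Icc a b := fun x => projIcc a b hg.lt.le x
  have he : Continuous e := continuous_projIcc_coe hg.lt.le
  have hmem : ∀ t ∈ Icc u v, (t : EReal) ∈ Icc a b := fun t ht =>
    ⟨hau.trans (EReal.coe_le_coe ht.1), (EReal.coe_le_coe ht.2).trans hvb⟩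
  have hmem' : ∀ t ∈ Ioo u v, (t : EReal) ∈ Ioo a b := fun t ht =>
    ⟨hau.trans_lt (EReal.coe_lt_coe ht.1), (EReal.coe_lt_coe ht.2).trans_le hvb⟩
  have hinj : InjOn e (Icc u v) := fun x hx y hy hxy => by
    have := congrArg Subtype.val hxy
    rw [coe_projIcc_of_mem hg.lt.le (hmem x hx), coe_projIcc_of_mem hg.lt.le (hmem y hy)] at this
    exact EReal.coe_injective this
  refine abs_sub_le_of_hasDerivAt_off_countable (h := fun t => (g (e t) : EReal).toReal) huv
    (S := Icc u v ∩ e ⁻¹' Q) ?_ ?_ fun t ht => ?_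
  · exact MapsTo.countable_of_injOn (f := e) (fun x hx => hx.2)
      (hinj.mono inter_subset_left) hg.countable
  · exact EReal.continuousOn_toReal.comp
      (continuous_subtype_val.comp (hg.continuous.comp he)).continuousOn hfin
  · obtain ⟨s, hs, hst⟩ := exists_hasDerivAt_toReal_projIcc hg hl (hmem' t ht.1)
      fun h => ht.2 ⟨Ioo_subset_Icc_self ht.1, h⟩
    exact ⟨s, hs.le, hst⟩

lemma isBounded_toReal_image_of_isPreconnected (hg : IsCPMM g Q) (hl : HasConstantSlopeExt g Q l)
    {O : Set (Icc a b)} (hO : IsPreconnected O)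
    (hfin : ∀ p ∈ O, (p : EReal) ∈ ({⊥, ⊤}ᶜ : Set EReal))
    (hgfin : ∀ p ∈ O, (g p : EReal) ∈ ({⊥, ⊤}ᶜ : Set EReal))
    (hbdd : Bornology.IsBounded ((fun p : Icc a b => (p : EReal).toReal) '' O)) :
    Bornology.IsBounded ((fun p => (g p : EReal).toReal) '' O) := by
  obtain ⟨R, hR⟩ := Metric.isBounded_image_iff.1 hbdd
  have hreal : ∀ p ∈ O, ∃ u : ℝ, (u : EReal) ∈ Icc a b ∧ projIcc a b hg.lt.le u = p := by
    intro p hp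
    have hcoe : (((p : EReal).toReal : ℝ) : EReal) = p :=
      EReal.coe_toReal (fun h => hfin p hp (Or.inr h)) (fun h => hfin p hp (Or.inl h))
    exact ⟨(p : EReal).toReal, hcoe ▸ p.2, by rw [hcoe, projIcc_val]⟩
  have hle : ∀ p ∈ O, ∀ q ∈ O, p ≤ q →
      dist (g q : EReal).toReal (g p : EReal).toReal ≤ |l| * R := by
    intro p hp q hq hpq
    have hRpq := hR q hq p hp
    obtain ⟨u, hu, rfl⟩ := hreal p hp
    obtain ⟨v, hv, rfl⟩ := hreal q hq
    rw [← Subtype.coe_le_coe, coe_projIcc_of_mem _ hu, coe_projIcc_of_mem _ hv,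
      EReal.coe_le_coe_iff] at hpq
    simp only [coe_projIcc_of_mem _ hu, coe_projIcc_of_mem _ hv, EReal.toReal_coe] at hRpq
    refine (abs_toReal_projIcc_sub_le hg hl hpq hu.1 hv.2 fun t ht => hgfin _ ?_).trans
      (mul_le_mul (le_abs_self l) hRpq (abs_nonneg _) (abs_nonneg l))
    exact hO.ordConnected.out hp hq ⟨monotone_projIcc _ (EReal.coe_le_coe ht.1),
      monotone_projIcc _ (EReal.coe_le_coe ht.2)⟩
  refine Metric.isBounded_image_iff.2 ⟨|l| * R, fun p hp q hq => ?_⟩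
  rcases le_total p q with hpq | hqp
  · rw [dist_comm]; exact hle p hp q hq hpq
  · exact hle q hq p hp hqp

section Conjugacy

variable {X : Type*} [ConditionallyCompleteLinearOrder X] [BoundedOrder X] [DenselyOrdered X]
  [TopologicalSpace X] [OrderTopology X]

lemma not_isMin_and_not_isMax_apply_iff {Y : Type*} [LinearOrder Y] [TopologicalSpace Y]
    [OrderClosedTopology Y] (ψ : X ≃ₜ Y) {x : X} :
    ¬ IsMin (ψ x) ∧ ¬ IsMax (ψ x) ↔ ¬ IsMin x ∧ ¬ IsMax x := by
  rcases ψ.continuous.strictMono_of_inj_boundedOrder' ψ.injective with h | h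
  · let o := h.orderIsoOfSurjective ψ ψ.surjective
    rw [show ψ x = o x from rfl, o.isMin_apply, o.isMax_apply]
  · let o := StrictMono.orderIsoOfSurjective (OrderDual.toDual ∘ ψ) h.dual_right
      (OrderDual.toDual.surjective.comp ψ.surjective)
    rw [show IsMin (ψ x) ↔ IsMax x from isMax_toDual_iff.symm.trans o.isMax_apply,
      show IsMax (ψ x) ↔ IsMin x from isMin_toDual_iff.symm.trans o.isMin_apply, and_comm]

lemma coe_mem_compl_bot_top {p : Icc a b} (hp : ¬ IsMin p ∧ ¬ IsMax p) :
    (p : EReal) ∈ ({⊥, ⊤}ᶜ : Set EReal) := by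
  rintro (h | h)
  · exact hp.1 fun q _ => show (p : EReal) ≤ q from h ▸ bot_le
  · exact hp.2 fun q _ => show (q : EReal) ≤ p from (mem_singleton_iff.1 h) ▸ le_top

lemma not_isMin_and_not_isMax_of_mem_Ioo {p : Icc a b} (hp : (p : EReal) ∈ Ioo a b) :
    ¬ IsMin p ∧ ¬ IsMax p := by
  have hab := hp.1.trans hp.2
  exact ⟨fun h => (h (b := ⟨a, le_rfl, hab.le⟩) hp.1.le).not_gt hp.1,
    fun h => (h (b := ⟨b, hab.le, le_rfl⟩) hp.2.le).not_gt hp.2⟩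

lemma not_isBounded_toReal_image (hab : a < b) (hinf : a = ⊥ ∨ b = ⊤) :
    ¬ Bornology.IsBounded
      ((fun p : Icc a b => (p : EReal).toReal) '' {p | ¬ IsMin p ∧ ¬ IsMax p}) := by
  have himage : ∀ t : ℝ, (t : EReal) ∈ Ioo a b →
      t ∈ (fun p : Icc a b => (p : EReal).toReal) '' {p | ¬ IsMin p ∧ ¬ IsMax p} := fun t ht =>
    ⟨⟨t, Ioo_subset_Icc_self ht⟩, not_isMin_and_not_isMax_of_mem_Ioo ht, rfl⟩
  obtain ⟨c, hac, hcb⟩ := EReal.lt_iff_exists_real_btwn.1 hab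
  intro hbdd
  rcases hinf with rfl | rfl
  · obtain ⟨R, hR⟩ := hbdd.bddBelow
    have := hR (himage (min c R - 1) ⟨EReal.bot_lt_coe _,
      (EReal.coe_lt_coe (by linarith [min_le_left c R])).trans hcb⟩)
    linarith [min_le_right c R]
  · obtain ⟨R, hR⟩ := hbdd.bddAbove
    have := hR (himage (max c R + 1)
      ⟨hac.trans (EReal.coe_lt_coe (by linarith [le_max_left c R])), EReal.coe_lt_top _⟩)
    linarith [le_max_right c R]

lemma isBounded_toReal_image_Icc (ψ : X ≃ₜ Icc a b) {x y : X} (hx : ¬ IsMin x) (hy : ¬ IsMax y) :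
    Bornology.IsBounded ((fun z => (ψ z : EReal).toReal) '' Icc x y) := by
  refine (isCompact_Icc.image_of_continuousOn ?_).isBounded
  refine EReal.continuousOn_toReal.comp (continuous_subtype_val.comp ψ.continuous).continuousOn
    fun z hz => coe_mem_compl_bot_top ((not_isMin_and_not_isMax_apply_iff ψ).2 ⟨?_, ?_⟩)
  · exact fun h => hx (h.mono hz.1)
  · exact fun h => hy (h.mono hz.2)

lemma isBounded_toReal_image_of_conj {f : X → X} {ψ : X ≃ₜ Icc a b} (hg : IsCPMM g Q)
    (hl : HasConstantSlopeExt g Q l) (hψ : ∀ x, ψ (f x) = g (ψ x)) {O : Set X}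
    (hO : IsPreconnected O) (hint : ∀ x ∈ O, ¬ IsMin x ∧ ¬ IsMax x)
    (hfint : ∀ x ∈ O, ¬ IsMin (f x) ∧ ¬ IsMax (f x))
    (hbdd : Bornology.IsBounded ((fun x => (ψ x : EReal).toReal) '' O)) :
    Bornology.IsBounded ((fun x => (ψ x : EReal).toReal) '' (f '' O)) := by
  have himage := isBounded_toReal_image_of_isPreconnected hg hl
    (hO.image ψ ψ.continuous.continuousOn)
    (forall_mem_image.2 fun x hx =>
      coe_mem_compl_bot_top ((not_isMin_and_not_isMax_apply_iff ψ).2 (hint x hx)))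
    (forall_mem_image.2 fun x hx => hψ x ▸
      coe_mem_compl_bot_top ((not_isMin_and_not_isMax_apply_iff ψ).2 (hfint x hx)))
    (by rwa [image_image])
  simpa only [image_image, hψ] using himage

theorem not_isConjugateTo_of_infinite_length {f : X → X} {O₁ O₂ : Set X} {x y : X}
    (hx : ¬ IsMin x) (hy : ¬ IsMax y) (hsub : O₁ ⊆ Icc x y) (hO₁ : IsPreconnected O₁)
    (hO₂ : IsPreconnected O₂) (hf₁ : ∀ z ∈ O₁, ¬ IsMin (f z) ∧ ¬ IsMax (f z))
    (hO₁₂ : O₂ ⊆ f '' O₁) (hf₂ : f '' O₂ = {z | ¬ IsMin z ∧ ¬ IsMax z})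
    (hinf : a = ⊥ ∨ b = ⊤) (hg : IsCPMM g Q) (hl : HasConstantSlopeExt g Q l) :
    ¬ IsConjugateTo f g := by
  rintro ⟨ψ, hψ⟩
  have hint₁ : ∀ z ∈ O₁, ¬ IsMin z ∧ ¬ IsMax z := fun z hz =>
    ⟨fun h => hx (h.mono (hsub hz).1), fun h => hy (h.mono (hsub hz).2)⟩
  have hint₂ : ∀ z ∈ O₂, ¬ IsMin z ∧ ¬ IsMax z := by
    rintro z hz
    obtain ⟨w, hw, rfl⟩ := hO₁₂ hz
    exact hf₁ w hw
  have hbdd₁ := (isBounded_toReal_image_Icc ψ hx hy).subset (image_mono hsub)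
  have hbdd₂ := (isBounded_toReal_image_of_conj hg hl hψ hO₁ hint₁ hf₁ hbdd₁).subset
    (image_mono hO₁₂)
  have hbdd := isBounded_toReal_image_of_conj hg hl hψ hO₂ hint₂
    (forall_mem_image.1 fun z hz => hf₂.subset hz) hbdd₂
  refine not_isBounded_toReal_image hg.lt hinf (hbdd.subset ?_)
  rintro _ ⟨p, hp, rfl⟩
  refine ⟨ψ.symm p, hf₂ ▸ ?_, by simp⟩
  exact (not_isMin_and_not_isMax_apply_iff ψ).1 (by simpa using hp)

end Conjugacy

end ExtendedLine

section Entropy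

lemma exists_finset_unitInterval_dist_le {m : ℕ} (hm : 0 < m) :
    ∃ s : Finset (Icc (0 : ℝ) 1), s.card ≤ m + 1 ∧ ∀ x, ∃ y ∈ s, dist x y ≤ 1 / m := by
  classical
  have hm' : (0 : ℝ) < m := by exact_mod_cast hm
  have hmem : ∀ k : Fin (m + 1), (k : ℝ) / m ∈ Icc (0 : ℝ) 1 := fun k =>
    ⟨by positivity, (div_le_one hm').2 (by exact_mod_cast Nat.lt_succ_iff.1 k.2)⟩
  refine ⟨Finset.univ.image fun k => ⟨_, hmem k⟩, ?_, fun x => ?_⟩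
  · simpa using Finset.card_image_le (s := Finset.univ)
      (f := fun k => (⟨_, hmem k⟩ : Icc (0 : ℝ) 1))
  have hfloor : ⌊(x : ℝ) * m⌋₊ ≤ m := by
    refine Nat.floor_le_of_le ?_
    nlinarith [x.2.2]
  refine ⟨⟨_, hmem ⟨_, Nat.lt_succ_iff.2 hfloor⟩⟩,
    Finset.mem_image_of_mem _ (Finset.mem_univ _), ?_⟩
  have hle : (⌊(x : ℝ) * m⌋₊ : ℝ) / m ≤ x := by
    rw [div_le_iff₀ hm']
    exact Nat.floor_le (mul_nonneg x.2.1 hm'.le)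
  have hge : (x : ℝ) ≤ (⌊(x : ℝ) * m⌋₊ : ℝ) / m + 1 / m := by
    rw [← add_div, le_div_iff₀ hm']
    exact (Nat.lt_floor_add_one _).le
  rw [Subtype.dist_eq, Real.dist_eq, abs_of_nonneg (sub_nonneg.2 hle)]
  linarith

lemma isDynCoverOf_of_lipschitzWith {X : Type*} [PseudoMetricSpace X] {T : X → X} {K : NNReal}
    (hK : 1 ≤ K) (hT : LipschitzWith K T) {s : Set X} {δ ε : ℝ} {n : ℕ}
    (hs : ∀ x, ∃ y ∈ s, dist x y ≤ δ) (hδ : K ^ n * δ < ε) :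
    Dynamics.IsDynCoverOf T univ {p | dist p.1 p.2 < ε} n s := by
  intro x _
  obtain ⟨y, hy, hxy⟩ := hs x
  refine ⟨y, hy, Dynamics.mem_dynEntourage.2 fun j hj => ?_⟩
  calc dist (T^[j] x) (T^[j] y) ≤ K ^ j * dist x y := by
        simpa using (hT.iterate j).dist_le_mul x y
    _ ≤ K ^ n * δ := by gcongr
    _ < ε := hδ

lemma coverMincard_le_of_lipschitzWith {T : Icc (0 : ℝ) 1 → Icc (0 : ℝ) 1} {K : NNReal}
    (hK : 1 ≤ K) (hT : LipschitzWith K T) {ε : ℝ} (hε : 0 < ε) (n : ℕ) :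
    (Dynamics.coverMincard T univ {p | dist p.1 p.2 < ε} n : ℝ≥0∞) ≤
      ENNReal.ofReal (2 / ε + 2) * (K : ℝ≥0∞) ^ n := by
  have hpow : (1 : ℝ) ≤ (K : ℝ) ^ n := one_le_pow₀ (by exact_mod_cast hK)
  have hpos : 0 < 2 * (K : ℝ) ^ n / ε := by positivity
  set m := ⌈2 * (K : ℝ) ^ n / ε⌉₊
  have hm : 2 * (K : ℝ) ^ n / ε ≤ m := Nat.le_ceil _
  have hm0 : (0 : ℝ) < m := hpos.trans_le hm
  have hδ : (K : ℝ) ^ n * (1 / m) < ε := by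
    rw [div_le_iff₀ hε] at hm
    rw [mul_one_div, div_lt_iff₀ hm0]
    linarith
  obtain ⟨s, hcard, hs⟩ := exists_finset_unitInterval_dist_le (m := m) (by exact_mod_cast hm0)
  have hcard' : (s.card : ℝ) ≤ (2 / ε + 2) * K ^ n := by
    have h1 : (s.card : ℝ) ≤ m + 1 := by exact_mod_cast hcard
    have h2 : (m : ℝ) < 2 * (K : ℝ) ^ n / ε + 1 := Nat.ceil_lt_add_one hpos.le
    have h3 : 2 * (K : ℝ) ^ n / ε = 2 / ε * K ^ n := by ring
    linarith
  calc (Dynamics.coverMincard T univ {p | dist p.1 p.2 < ε} n : ℝ≥0∞)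
      ≤ ((s.card : ℕ∞) : ℝ≥0∞) := ENat.toENNReal_mono
        (isDynCoverOf_of_lipschitzWith hK hT hs hδ).coverMincard_le_card
    _ = ENNReal.ofReal s.card := by simp
    _ ≤ ENNReal.ofReal ((2 / ε + 2) * K ^ n) := ENNReal.ofReal_le_ofReal hcard'
    _ = _ := by rw [ENNReal.ofReal_mul (by positivity), ENNReal.ofReal_pow K.coe_nonneg,
        ENNReal.ofReal_coe_nnreal]

theorem coverEntropy_le_log_of_lipschitzWith {T : Icc (0 : ℝ) 1 → Icc (0 : ℝ) 1} {K : NNReal}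
    (hK : 1 ≤ K) (hT : LipschitzWith K T) :
    Dynamics.coverEntropy T univ ≤ ENNReal.log K := by
  refine iSup₂_le fun U hU => ?_
  obtain ⟨ε, hε, hεU⟩ := Metric.mem_uniformity_dist.1 hU
  rw [Dynamics.coverEntropyEntourage, ← ExpGrowth.expGrowthSup_pow]
  refine ExpGrowth.expGrowthSup_le_of_eventually_le (b := ENNReal.ofReal (2 / ε + 2))
    ENNReal.ofReal_ne_top
    (Eventually.of_forall fun n => ?_)
  exact (ENat.toENNReal_mono (Dynamics.coverMincard_antitone T univ n fun p hp => hεU hp)).trans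
    (coverMincard_le_of_lipschitzWith hK hT hε n)

variable {X ι : Type*} {Z : ι → Set X}

lemma exists_pos_forall_le_dist [PseudoMetricSpace X] [T2Space X] [Finite ι]
    (hZ : ∀ i, IsCompact (Z i)) (hd : Pairwise fun i j => Disjoint (Z i) (Z j)) :
    ∃ δ : ℝ, 0 < δ ∧ ∀ i j, i ≠ j → ∀ x ∈ Z i, ∀ y ∈ Z j, δ ≤ dist x y := by
  have hsep : ∀ q : ι × ι, ∀ᶠ δ in 𝓝[>] (0 : ℝ), q.1 ≠ q.2 → ∀ x ∈ Z q.1, ∀ y ∈ Z q.2,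
      δ ≤ dist x y := by
    rintro ⟨i, j⟩
    by_cases hij : i = j
    · exact Eventually.of_forall fun δ h => absurd hij h
    obtain ⟨r, hr, hlt⟩ := Metric.exists_pos_forall_lt_edist (hZ i) (hZ j).isClosed (hd hij)
    filter_upwards [Ioo_mem_nhdsGT (show (0 : ℝ) < r from hr)] with δ hδ _ x hx y hy
    have hxy := hlt x hx y hy
    rw [edist_nndist, ENNReal.coe_lt_coe] at hxy
    exact hδ.2.le.trans (show (r : ℝ) < dist x y from hxy).le
  obtain ⟨δ, hδ, hpos⟩ := ((eventually_all.2 hsep).and self_mem_nhdsWithin).exists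
  exact ⟨δ, hpos, fun i j => hδ (i, j)⟩

lemma isDynNetIn_range_of_separated [PseudoMetricSpace X] {T : X → X} {κ : Type*} {x : κ → X}
    {δ : ℝ} {n : ℕ} (hsep : ∀ s t, s ≠ t → ∃ i < n, δ ≤ dist (T^[i] (x s)) (T^[i] (x t))) :
    Dynamics.IsDynNetIn T univ {p | dist p.1 p.2 < δ / 2} n (range x) := by
  refine ⟨subset_univ _, ?_⟩
  rintro _ ⟨s, rfl⟩ _ ⟨t, rfl⟩ hst
  obtain ⟨i, hi, hle⟩ := hsep s t fun h => hst (h ▸ rfl)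
  refine Set.disjoint_left.2 fun w hs ht => ?_
  have hs' : dist (T^[i] (x s)) (T^[i] w) < δ / 2 := Dynamics.mem_ball_dynEntourage.1 hs i hi
  have ht' : dist (T^[i] (x t)) (T^[i] w) < δ / 2 := Dynamics.mem_ball_dynEntourage.1 ht i hi
  linarith [dist_triangle_right (T^[i] (x s)) (T^[i] (x t)) (T^[i] w)]

lemma card_pow_le_netMaxcard [MetricSpace X] [Fintype ι] {T : X → X} {δ : ℝ} (hδ : 0 < δ)
    (hsep : ∀ i j, i ≠ j → ∀ x ∈ Z i, ∀ y ∈ Z j, δ ≤ dist x y) {N k : ℕ} (hN : 0 < N)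
    (horb : ∀ s : Fin k → ι, ∃ x, ∀ j : Fin k, T^[j * N] x ∈ Z (s j)) :
    ((Fintype.card ι ^ k : ℕ) : ℕ∞) ≤
      Dynamics.netMaxcard T univ {p | dist p.1 p.2 < δ / 2} (k * N) := by
  classical
  choose x hx using horb
  have hsep' : ∀ s t, s ≠ t → ∃ i < k * N, δ ≤ dist (T^[i] (x s)) (T^[i] (x t)) := by
    intro s t hst
    obtain ⟨j, hj⟩ := Function.ne_iff.1 hst
    exact ⟨j * N, Nat.mul_lt_mul_of_pos_right j.2 hN, hsep _ _ hj _ (hx s j) _ (hx t j)⟩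
  have hinj : Function.Injective x := by
    intro s t hst
    by_contra h
    obtain ⟨i, -, hi⟩ := hsep' s t h
    rw [hst, dist_self] at hi
    exact hδ.not_ge hi
  have hnet : Dynamics.IsDynNetIn T univ {p | dist p.1 p.2 < δ / 2} (k * N)
      (Finset.univ.image x : Finset X) := by
    simpa using isDynNetIn_range_of_separated hsep'
  simpa [Finset.card_image_of_injective _ hinj] using hnet.card_le_netMaxcard

theorem log_le_coverEntropy_of_horseshoe [MetricSpace X] [Fintype ι] {T : X → X}
    (hZ : ∀ i, IsCompact (Z i)) (hd : Pairwise fun i j => Disjoint (Z i) (Z j)) {N : ℕ}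
    (hN : 0 < N) (horb : ∀ k, ∀ s : Fin k → ι, ∃ x, ∀ j : Fin k, T^[j * N] x ∈ Z (s j))
    {β : ℝ≥0∞} (hβ : β ^ N ≤ Fintype.card ι) :
    ENNReal.log β ≤ Dynamics.coverEntropy T univ := by
  obtain ⟨δ, hδ, hsep⟩ := exists_pos_forall_le_dist hZ hd
  refine le_trans ?_ (Dynamics.netEntropyEntourage_le_coverEntropy T univ
    (Metric.dist_mem_uniformity (half_pos hδ)))
  refine Frequently.le_expGrowthSup (frequently_atTop.2 fun k => ?_)
  refine ⟨k * N, Nat.le_mul_of_pos_right k hN, ?_⟩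
  calc EReal.exp (ENNReal.log β * (k * N : ℕ)) = (β ^ N) ^ k := by
        rw [mul_comm, EReal.exp_nmul, ENNReal.exp_log, mul_comm, pow_mul]
    _ ≤ (Fintype.card ι : ℝ≥0∞) ^ k := by gcongr
    _ = (((Fintype.card ι ^ k : ℕ) : ℕ∞) : ℝ≥0∞) := by simp
    _ ≤ _ := ENat.toENNReal_mono (card_pow_le_netMaxcard hδ hsep hN (horb k))

end Entropy

section Growth

lemma tendsto_const_mul_pow_rpow_one_div {c : ℝ≥0∞} (hc : c ≠ 0) (hc' : c ≠ ⊤) {L : ℝ≥0∞}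
    (hL : L ≠ ⊤) :
    Tendsto (fun n : ℕ => (c * L ^ n) ^ (1 / (n : ℝ))) atTop (𝓝 L) := by
  have hroot : Tendsto (fun n : ℕ => c ^ (1 / (n : ℝ))) atTop (𝓝 1) := by
    lift c to NNReal using hc'
    have hc0 : c ≠ 0 := by simpa using hc
    have hlim := Tendsto.nnrpow (tendsto_const_nhds (x := c)) tendsto_one_div_atTop_nhds_zero_nat
      (Or.inl hc0)
    rw [NNReal.rpow_zero] at hlim
    simpa [ENNReal.coe_rpow_of_ne_zero hc0] using ENNReal.tendsto_coe.2 hlim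
  have hmul := ENNReal.Tendsto.mul_const hroot (Or.inr hL)
  rw [one_mul] at hmul
  refine hmul.congr' ?_
  filter_upwards [eventually_ne_atTop 0] with n hn
  rw [ENNReal.mul_rpow_of_nonneg _ _ (by positivity), one_div, ENNReal.pow_rpow_inv_natCast hn]

lemma tendsto_rpow_one_div_of_le_of_le {x : ℕ → ℝ≥0∞} {c L : ℝ≥0∞} (hc : c ≠ 0) (hc' : c ≠ ⊤)
    (hL : L ≠ ⊤) (hlow : ∀ᶠ n in atTop, c * L ^ n ≤ x n) (hup : ∀ n, x n ≤ L ^ n) :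
    Tendsto (fun n : ℕ => x n ^ (1 / (n : ℝ))) atTop (𝓝 L) := by
  have hone := tendsto_const_mul_pow_rpow_one_div one_ne_zero ENNReal.one_ne_top hL
  simp only [one_mul] at hone
  refine tendsto_of_tendsto_of_tendsto_of_le_of_le'
    (tendsto_const_mul_pow_rpow_one_div hc hc' hL) hone ?_
    (Eventually.of_forall fun n => ENNReal.rpow_le_rpow (hup n) (by positivity))
  filter_upwards [hlow] with n hn
  exact ENNReal.rpow_le_rpow hn (by positivity)

lemma limsup_rpow_one_div_le {x : ℕ → ℝ≥0∞} {K M : NNReal}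
    (hx : ∀ᶠ n in atTop, x n ≤ K * (M : ℝ≥0∞) ^ n) :
    limsup (fun n : ℕ => x n ^ (1 / (n : ℝ))) atTop ≤ M := by
  rw [← (tendsto_const_mul_pow_rpow_one_div (c := K + 1) (by simp) (by simp)
    ENNReal.coe_ne_top).limsup_eq]
  refine limsup_le_limsup ?_
  filter_upwards [hx] with n hn
  refine ENNReal.rpow_le_rpow (hn.trans ?_) (by positivity)
  gcongr
  exact le_self_add

variable {a e : ℕ → ℝ} {K L M : ℝ}

lemma le_mul_pow_of_renewal (hM : 0 ≤ M) (hML : M < L) (hK : 0 ≤ K) (ha : ∀ n, a n ≤ L ^ n)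
    (he0 : e 0 = 0) (he : ∀ n, e (n + 1) ≤ M * e n + K * a n) (n : ℕ) :
    e n ≤ K / (L - M) * L ^ n := by
  have hLM : 0 < L - M := sub_pos.2 hML
  induction n with
  | zero => rw [he0, pow_zero, mul_one]; positivity
  | succ n ih =>
    calc e (n + 1) ≤ M * e n + K * a n := he n
      _ ≤ M * (K / (L - M) * L ^ n) + K * L ^ n := by gcongr; exact ha n
      _ = K / (L - M) * L ^ (n + 1) := by field_simp; ring

lemma le_pow_mul_add_of_renewal (hM : 0 ≤ M) (hK : 0 ≤ K) (ha : Monotone a)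
    (he : ∀ n, e (n + 1) ≤ M * e n + K * a n) (q n : ℕ) :
    e (n + q) ≤ M ^ q * e n + K * (∑ j ∈ Finset.range q, M ^ j) * a (n + q) := by
  induction q with
  | zero => simp
  | succ q ih =>
    have hmono : a (n + q) ≤ a (n + (q + 1)) := ha (by omega)
    calc e (n + (q + 1)) ≤ M * e (n + q) + K * a (n + q) := he (n + q)
      _ ≤ M * (M ^ q * e n + K * (∑ j ∈ Finset.range q, M ^ j) * a (n + (q + 1)))
          + K * a (n + (q + 1)) := by gcongr; exact ih.trans (by gcongr)
      _ = M ^ (q + 1) * e n + K * (M * ∑ j ∈ Finset.range q, M ^ j + 1) * a (n + (q + 1)) := by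
        ring
      _ = _ := by rw [← geom_sum_succ]

/-- Here `a n` counts the loops at a vertex and `e n` is the mass away from it. Of this mass, the
part that left the vertex more than `q` steps ago is at most a `(M / L) ^ q`-fraction of `L ^ n`. -/
lemma exists_eventually_mul_pow_le_of_renewal {v C : ℝ} (hM : 0 ≤ M) (hML : M < L) (hK : 0 ≤ K)
    (hC : 0 ≤ C) (hv : 0 < v) (hmono : Monotone a) (ha : ∀ n, a n ≤ L ^ n)
    (he0 : e 0 = 0) (he : ∀ n, e (n + 1) ≤ M * e n + K * a n)
    (hLv : ∀ n, v * L ^ n ≤ v * a n + C * e n) :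
    ∃ c > 0, ∀ᶠ n in atTop, c * L ^ n ≤ a n := by
  have hL : 0 < L := hM.trans_lt hML
  have hLM : 0 < L - M := sub_pos.2 hML
  obtain ⟨q, hq⟩ : ∃ q : ℕ, C * (K / (L - M)) * (M / L) ^ q ≤ v / 2 := by
    have hlim := (tendsto_pow_atTop_nhds_zero_of_lt_one (div_nonneg hM hL.le)
      ((div_lt_one hL).2 hML)).const_mul (C * (K / (L - M)))
    rw [mul_zero] at hlim
    exact (hlim.eventually_le_const (half_pos hv)).exists
  set c := v + C * (K * ∑ j ∈ Finset.range q, M ^ j)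
  have hc : 0 < c := by positivity
  refine ⟨v / 2 / c, by positivity, ?_⟩
  filter_upwards [eventually_ge_atTop q] with n hn
  obtain ⟨n, rfl⟩ := Nat.exists_eq_add_of_le' hn
  have herror : C * (M ^ q * e n) ≤ v / 2 * L ^ (n + q) :=
    calc C * (M ^ q * e n) ≤ C * (M ^ q * (K / (L - M) * L ^ n)) := by
          gcongr; exact le_mul_pow_of_renewal hM hML hK ha he0 he n
      _ = C * (K / (L - M)) * (M / L) ^ q * L ^ (n + q) := by
          rw [div_pow, pow_add]; field_simp
      _ ≤ v / 2 * L ^ (n + q) := by gcongr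
  have hmain : v * L ^ (n + q) ≤ v / 2 * L ^ (n + q) + c * a (n + q) :=
    calc v * L ^ (n + q) ≤ v * a (n + q) + C * e (n + q) := hLv _
      _ ≤ v * a (n + q) + C * (M ^ q * e n
          + K * (∑ j ∈ Finset.range q, M ^ j) * a (n + q)) := by
          gcongr; exact le_pow_mul_add_of_renewal hM hK hmono he q n
      _ = C * (M ^ q * e n) + c * a (n + q) := by ring
      _ ≤ v / 2 * L ^ (n + q) + c * a (n + q) := by gcongr
  rw [div_mul_eq_mul_div, div_le_iff₀ hc]
  linarith

end Growth

section Paths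

lemma encard_eq_tsum_fiber {α ι : Type*} (A : Set α) (g : α → ι) :
    (A.encard : ℝ≥0∞) = ∑' i, ((A ∩ g ⁻¹' {i}).encard : ℝ≥0∞) := by
  rw [← ENNReal.tsum_set_one, ← ENNReal.tsum_fiberwise (fun _ : A => 1) (fun a => g a)]
  refine tsum_congr fun i => ?_
  rw [ENNReal.tsum_set_one, ← Subtype.val_injective.encard_image]
  congr 2
  ext a
  simp [and_comm]

variable {V V' : Type*}

/-- The transition operator of the 0-1 matrix `T`: the value of `succSum T v` at `u` is the sum of
`v` over the successors of `u`. -/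
noncomputable def succSum (T : Matrix V V ℝ) : (V → ℝ≥0∞) →ₗ[ℝ≥0∞] (V → ℝ≥0∞) where
  toFun v u := ∑' z, {z | T u z = 1}.indicator v z
  map_add' v v' := by
    funext u
    simp only [indicator_add', Pi.add_apply, ENNReal.tsum_add]
  map_smul' c v := by
    funext u
    simp only [← ENNReal.tsum_mul_left, RingHom.id_apply, Pi.smul_apply, smul_eq_mul]
    exact tsum_congr fun z => indicator_const_smul_apply _ c v z

/-- The number of paths of length `n` from `u` to `w` in the transition graph of `T`. -/
noncomputable def pathCount (T : Matrix V V ℝ) (n : ℕ) (u w : V) : ℝ≥0∞ :=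
  ((pathSet T n u w).encard : ℝ≥0∞)

variable {T : Matrix V V ℝ} {m n : ℕ} {u w z : V} {v : V → ℝ≥0∞}

lemma succSum_apply (v : V → ℝ≥0∞) (u : V) :
    succSum T v u = ∑' z, {z | T u z = 1}.indicator v z := rfl

lemma monotone_succSum_pow (n : ℕ) : Monotone (succSum T ^ n) := by
  have hmono : Monotone (succSum T) := fun _ _ h u =>
    ENNReal.tsum_le_tsum fun z => indicator_le_indicator (h z)
  rw [Module.End.coe_pow]
  exact hmono.iterate n

lemma monotone_succSum : Monotone (succSum T) := by
  simpa using monotone_succSum_pow (T := T) 1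

lemma le_succSum (h : T u z = 1) : v z ≤ succSum T v u := by
  have hle := ENNReal.le_tsum (f := {z | T u z = 1}.indicator v) z
  rwa [indicator_of_mem (show z ∈ {z | T u z = 1} from h)] at hle

lemma succSum_pow_of_eigen {L : ℝ≥0∞} (hv : succSum T v = L • v) (n : ℕ) :
    (succSum T ^ n) v = L ^ n • v := by
  induction n with
  | zero => simp
  | succ n ih => rw [pow_succ, Module.End.mul_apply, hv, map_smul, ih, smul_smul, pow_succ']

lemma tail_mem_pathSet {p : Fin (n + 2) → V} (hp : p ∈ pathSet T (n + 1) u w) :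
    T u (p 1) = 1 ∧ Fin.tail p ∈ pathSet T n (p 1) w := by
  obtain ⟨hstart, hend, hstep⟩ := hp
  have hfirst := hstep 0
  rw [Fin.castSucc_zero, hstart] at hfirst
  exact ⟨hfirst, rfl, hend, fun i => hstep i.succ⟩

lemma cons_mem_pathSet (h : T u z = 1) {p : Fin (n + 1) → V} (hp : p ∈ pathSet T n z w) :
    (Fin.cons u p : Fin (n + 2) → V) ∈ pathSet T (n + 1) u w := by
  obtain ⟨hstart, hend, hstep⟩ := hp
  refine ⟨rfl, ?_, Fin.cases ?_ fun i => ?_⟩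
  · rw [← Fin.succ_last, Fin.cons_succ, hend]
  · rw [Fin.castSucc_zero, Fin.cons_zero, Fin.cons_succ, hstart, h]
  · rw [← Fin.succ_castSucc, Fin.cons_succ, Fin.cons_succ]
    exact hstep i

lemma injOn_tail_pathSet : InjOn Fin.tail (pathSet T (n + 1) u w) := fun p hp p' hp' h => by
  rw [← Fin.cons_self_tail p, ← Fin.cons_self_tail p', h, hp.1, hp'.1]

lemma pathCount_zero (w : V) : (pathCount T 0 · w) = ({w} : Set V).indicator 1 := by
  funext u
  have hset : pathSet T 0 u w = {p | p = (fun _ => u) ∧ u = w} := by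
    ext p
    refine ⟨fun ⟨h, h', _⟩ => ⟨?_, h.symm.trans h'⟩, ?_⟩
    · funext i
      rw [Fin.fin_one_eq_zero i, h]
    · rintro ⟨rfl, rfl⟩
      exact ⟨rfl, rfl, fun i => i.elim0⟩
  rw [pathCount, hset]
  by_cases h : u = w <;> simp [h]

lemma pathCount_succ (n : ℕ) (w : V) :
    (pathCount T (n + 1) · w) = succSum T (pathCount T n · w) := by
  funext u
  rw [pathCount, encard_eq_tsum_fiber _ (fun p => p 1), succSum_apply]
  refine tsum_congr fun z => ?_
  have hinj : InjOn Fin.tail (pathSet T (n + 1) u w ∩ (fun p => p 1) ⁻¹' {z}) :=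
    injOn_tail_pathSet.mono inter_subset_left
  rw [← hinj.encard_image]
  by_cases h : T u z = 1
  · rw [indicator_of_mem (show z ∈ {z | T u z = 1} from h), pathCount]
    congr 2
    ext p
    constructor
    · rintro ⟨q, ⟨hq, rfl⟩, rfl⟩
      exact (tail_mem_pathSet hq).2
    · exact fun hp => ⟨Fin.cons u p, ⟨cons_mem_pathSet h hp, hp.1⟩, Fin.tail_cons _ _⟩
  · have hempty : pathSet T (n + 1) u w ∩ (fun p => p 1) ⁻¹' {z} = ∅ :=
      eq_empty_of_forall_notMem fun p ⟨hp, hpz⟩ => h (hpz ▸ (tail_mem_pathSet hp).1)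
    rw [indicator_of_notMem (show z ∉ {z | T u z = 1} from h), hempty]
    simp

lemma pathCount_eq_succSum_pow (n : ℕ) (u w : V) :
    pathCount T n u w = (succSum T ^ n) (({w} : Set V).indicator 1) u := by
  suffices h : (pathCount T n · w) = (succSum T ^ n) (({w} : Set V).indicator 1) from
    congrFun h u
  induction n with
  | zero => rw [pathCount_zero, pow_zero, Module.End.one_apply]
  | succ n ih => rw [pathCount_succ, ih, pow_succ', Module.End.mul_apply]

lemma pathCount_mul_le (v : V → ℝ≥0∞) (n : ℕ) (u w : V) :
    pathCount T n u w * v w ≤ (succSum T ^ n) v u := by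
  have hle : v w • ({w} : Set V).indicator (1 : V → ℝ≥0∞) ≤ v := fun z => by
    by_cases h : z = w <;> simp [h]
  rw [pathCount_eq_succSum_pow, mul_comm, ← smul_eq_mul, ← Pi.smul_apply, ← map_smul]
  exact monotone_succSum_pow n hle u

lemma pathCount_mul_pathCount_le (m n : ℕ) (u w z : V) :
    pathCount T m u w * pathCount T n w z ≤ pathCount T (m + n) u z := by
  refine (pathCount_mul_le (pathCount T n · z) m u w).trans_eq ?_
  rw [pathCount_eq_succSum_pow, pow_add, Module.End.mul_apply,
    funext fun u => pathCount_eq_succSum_pow n u z]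

lemma pathCount_ne_zero_iff : pathCount T n u w ≠ 0 ↔ (pathSet T n u w).Nonempty := by
  simp [pathCount, nonempty_iff_ne_empty]

lemma one_le_pathCount (h : (pathSet T n u w).Nonempty) : 1 ≤ pathCount T n u w := by
  rw [pathCount, ← ENat.toENNReal_one, ENat.toENNReal_le]
  exact one_le_encard_iff_nonempty.2 h

lemma nonempty_pathSet_zero (u : V) : (pathSet T 0 u u).Nonempty :=
  pathCount_ne_zero_iff.1 (by rw [congrFun (pathCount_zero u) u]; simp)

lemma nonempty_pathSet_add (h : (pathSet T m u w).Nonempty) (h' : (pathSet T n w z).Nonempty) :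
    (pathSet T (m + n) u z).Nonempty := by
  rw [← pathCount_ne_zero_iff] at h h' ⊢
  exact ((mul_ne_zero h h').bot_lt.trans_le (pathCount_mul_pathCount_le m n u w z)).ne'

lemma nonempty_pathSet_one (h : T u w = 1) : (pathSet T 1 u w).Nonempty :=
  (nonempty_pathSet_zero w).imp' _ fun _ => cons_mem_pathSet h

variable (T) in
/-- The paths of length `n` from `u` to `w` that do not visit `w` at intermediate times. -/
def firstPassageSet (n : ℕ) (u w : V) : Set (Fin (n + 1) → V) :=
  {p ∈ pathSet T n u w | ∀ i : Fin (n + 1), i ≠ 0 → i ≠ Fin.last n → p i ≠ w}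

lemma firstPassageSet_one_encard_le (u w : V) :
    ((firstPassageSet T 1 u w).encard : ℝ≥0∞) ≤ {z | T u z = 1}.indicator 1 w :=
  calc ((firstPassageSet T 1 u w).encard : ℝ≥0∞) ≤ pathCount T 1 u w :=
        ENat.toENNReal_le.2 (encard_le_encard (sep_subset _ _))
    _ = {z | T u z = 1}.indicator 1 w := by
      rw [congrFun (pathCount_succ 0 w) u, pathCount_zero, succSum_apply, tsum_eq_single w]
      · by_cases h : T u w = 1 <;> simp [h]
      · intro z hz
        by_cases h : T u z = 1 <;> simp [h, hz]

lemma firstPassageSet_succ_encard_le (n : ℕ) (u w : V) :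
    ((firstPassageSet T (n + 2) u w).encard : ℝ≥0∞) ≤
      succSum T (({w}ᶜ : Set V).indicator fun z =>
        ((firstPassageSet T (n + 1) z w).encard : ℝ≥0∞)) u := by
  rw [encard_eq_tsum_fiber _ (fun p => p 1), succSum_apply]
  refine ENNReal.tsum_le_tsum fun z => ?_
  have hinj : InjOn Fin.tail (firstPassageSet T (n + 2) u w ∩ (fun p => p 1) ⁻¹' {z}) :=
    injOn_tail_pathSet.mono fun p hp => hp.1.1
  rw [← hinj.encard_image, indicator_indicator]
  by_cases h : z ∈ {z | T u z = 1} ∩ {w}ᶜ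
  · rw [indicator_of_mem h, ENat.toENNReal_le]
    refine encard_le_encard ?_
    rintro _ ⟨p, ⟨⟨hp, hp'⟩, rfl⟩, rfl⟩
    refine ⟨(tail_mem_pathSet hp).2, fun i _ hi => hp' i.succ (Fin.succ_ne_zero i) ?_⟩
    rwa [← Fin.succ_last, Ne, Fin.succ_inj]
  · have hempty : firstPassageSet T (n + 2) u w ∩ (fun p => p 1) ⁻¹' {z} = ∅ := by
      refine eq_empty_of_forall_notMem ?_
      rintro p ⟨⟨hp, hp'⟩, rfl⟩
      exact h ⟨(tail_mem_pathSet hp).1, hp' 1 (by simp) (by simp [Fin.ext_iff])⟩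
    rw [hempty]
    simp

/-- A taboo vector at the vertex `d` for the 0-1 matrix `T`: outside `d` it is a supersolution with
rate `M` of the chain killed at `d`, so that it controls both the loops that avoid `d` and the
time spent away from `d`. -/
structure IsTabooVector (T : Matrix V V ℝ) (d : V) (M K : NNReal) (h : V → ℝ≥0∞) : Prop where
  apply_self : h d = 0
  one_le : ∀ u ≠ d, T u d = 1 → 1 ≤ h u
  succSum_le : succSum T h ≤ (M : ℝ≥0∞) • h + (K : ℝ≥0∞) • ({d} : Set V).indicator 1

namespace IsTabooVector

variable {d : V} {M K : NNReal} {h : V → ℝ≥0∞}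

lemma succSum_self_le (hh : IsTabooVector T d M K h) : succSum T h d ≤ K := by
  simpa [hh.apply_self] using hh.succSum_le d

lemma firstPassageSet_encard_le (hh : IsTabooVector T d M K h) (n : ℕ) (hu : u ≠ d) :
    ((firstPassageSet T (n + 1) u d).encard : ℝ≥0∞) ≤ (M : ℝ≥0∞) ^ n * h u := by
  induction n generalizing u with
  | zero =>
    refine (firstPassageSet_one_encard_le u d).trans ?_
    by_cases hud : T u d = 1
    · simpa [hud] using hh.one_le u hu hud
    · simp [hud]
  | succ n ih =>
    have hind : ({d}ᶜ : Set V).indicator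
        (fun z => ((firstPassageSet T (n + 1) z d).encard : ℝ≥0∞)) ≤ (M : ℝ≥0∞) ^ n • h :=
      indicator_le fun z hz => ih hz
    calc ((firstPassageSet T (n + 2) u d).encard : ℝ≥0∞)
        ≤ succSum T ((M : ℝ≥0∞) ^ n • h) u :=
          (firstPassageSet_succ_encard_le n u d).trans (monotone_succSum hind u)
      _ = (M : ℝ≥0∞) ^ n * succSum T h u := by rw [map_smul, Pi.smul_apply, smul_eq_mul]
      _ ≤ (M : ℝ≥0∞) ^ n * (M * h u) := by
          gcongr
          simpa [hu] using hh.succSum_le u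
      _ = (M : ℝ≥0∞) ^ (n + 1) * h u := by rw [pow_succ, mul_assoc]

lemma firstReturnCount_le (hh : IsTabooVector T d M K h) (n : ℕ) :
    (firstReturnCount T d (n + 2) : ℝ≥0∞) ≤ K * (M : ℝ≥0∞) ^ n := by
  have hind : ({d}ᶜ : Set V).indicator
      (fun z => ((firstPassageSet T (n + 1) z d).encard : ℝ≥0∞)) ≤ (M : ℝ≥0∞) ^ n • h :=
    indicator_le fun z hz => hh.firstPassageSet_encard_le n hz
  calc (firstReturnCount T d (n + 2) : ℝ≥0∞)
      ≤ succSum T ((M : ℝ≥0∞) ^ n • h) d :=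
        (firstPassageSet_succ_encard_le n d d).trans (monotone_succSum hind d)
    _ = (M : ℝ≥0∞) ^ n * succSum T h d := by rw [map_smul, Pi.smul_apply, smul_eq_mul]
    _ ≤ K * (M : ℝ≥0∞) ^ n := by
        rw [mul_comm]
        gcongr
        exact hh.succSum_self_le

lemma firstReturnRate_le (hh : IsTabooVector T d M K h) (hM : 1 ≤ M) : firstReturnRate T d ≤ M := by
  refine limsup_rpow_one_div_le (K := K) ?_
  filter_upwards [eventually_ge_atTop 2] with n hn
  obtain ⟨n, rfl⟩ := Nat.exists_eq_add_of_le' hn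
  refine (hh.firstReturnCount_le n).trans ?_
  gcongr
  · exact_mod_cast hM
  · omega

lemma succSum_pow_succ_self_le (hh : IsTabooVector T d M K h) (n : ℕ) :
    (succSum T ^ (n + 1)) h d ≤ M * (succSum T ^ n) h d + K * pathCount T n d d := by
  have hle := monotone_succSum_pow (T := T) n hh.succSum_le d
  rwa [map_add, map_smul, map_smul, ← Module.End.mul_apply, ← pow_succ, Pi.add_apply,
    Pi.smul_apply, Pi.smul_apply, ← pathCount_eq_succSum_pow] at hle

lemma succSum_pow_self_ne_top (hh : IsTabooVector T d M K h)
    (hfin : ∀ n, pathCount T n d d ≠ ⊤) (n : ℕ) : (succSum T ^ n) h d ≠ ⊤ := by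
  induction n with
  | zero => simp [hh.apply_self]
  | succ n ih =>
    exact ((hh.succSum_pow_succ_self_le n).trans_lt (ENNReal.add_lt_top.2
      ⟨ENNReal.mul_lt_top ENNReal.coe_lt_top ih.lt_top,
        ENNReal.mul_lt_top ENNReal.coe_lt_top (hfin n).lt_top⟩)).ne

end IsTabooVector

lemma pathCount_self_le {L : ℝ≥0∞} (hv : succSum T v = L • v) (hu : v u ≠ 0) (hu' : v u ≠ ⊤)
    (n : ℕ) : pathCount T n u u ≤ L ^ n := by
  have hle := pathCount_mul_le (T := T) v n u u
  rw [succSum_pow_of_eigen hv, Pi.smul_apply, smul_eq_mul] at hle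
  exact (ENNReal.mul_le_mul_iff_left hu hu').1 hle

lemma monotone_pathCount_self (hu : T u u = 1) : Monotone (pathCount T · u u) :=
  monotone_nat_of_le_succ fun n => by
    rw [congrFun (pathCount_succ n u) u]
    exact le_succSum (v := (pathCount T n · u)) hu

namespace IsTabooVector

variable {d : V} {M K : NNReal} {h : V → ℝ≥0∞}

lemma exists_mul_pow_le_pathCount {L C : NNReal} (hh : IsTabooVector T d M K h)
    (hdd : T d d = 1) (hv : succSum T v = (L : ℝ≥0∞) • v) (hd : v d ≠ 0) (hd' : v d ≠ ⊤)
    (hvh : ∀ u ≠ d, v u ≤ C * h u) (hML : M < L) :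
    ∃ c : ℝ≥0∞, c ≠ 0 ∧ c ≠ ⊤ ∧ ∀ᶠ n in atTop, c * L ^ n ≤ pathCount T n d d := by
  have hup := pathCount_self_le hv hd hd'
  have hfin : ∀ n, pathCount T n d d ≠ ⊤ := fun n =>
    ne_top_of_le_ne_top (ENNReal.pow_ne_top ENNReal.coe_ne_top) (hup n)
  have hsplit : v ≤ v d • ({d} : Set V).indicator 1 + (C : ℝ≥0∞) • h := fun u => by
    rcases eq_or_ne u d with rfl | hu
    · simp
    · simpa [hu] using hvh u hu
  have hLv : ∀ n, v d * (L : ℝ≥0∞) ^ n ≤ v d * pathCount T n d d + C * (succSum T ^ n) h d := by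
    intro n
    have hle := monotone_succSum_pow (T := T) n hsplit d
    rwa [succSum_pow_of_eigen hv, map_add, map_smul, map_smul, Pi.add_apply, Pi.smul_apply,
      Pi.smul_apply, Pi.smul_apply, smul_eq_mul, smul_eq_mul, smul_eq_mul,
      ← pathCount_eq_succSum_pow, mul_comm] at hle
  obtain ⟨a, ha⟩ : ∃ a : ℕ → NNReal, ∀ n, pathCount T n d d = a n :=
    ⟨fun n => (pathCount T n d d).toNNReal, fun n => (ENNReal.coe_toNNReal (hfin n)).symm⟩
  obtain ⟨e, he⟩ : ∃ e : ℕ → NNReal, ∀ n, (succSum T ^ n) h d = e n :=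
    ⟨fun n => ((succSum T ^ n) h d).toNNReal,
      fun n => (ENNReal.coe_toNNReal (hh.succSum_pow_self_ne_top hfin n)).symm⟩
  have hstep := hh.succSum_pow_succ_self_le
  have hzero : (succSum T ^ 0) h d = 0 := hh.apply_self
  have hmono := monotone_pathCount_self hdd
  lift v d to NNReal using hd' with y
  simp only [ha, he] at hup hLv hstep hzero hmono ⊢
  obtain ⟨c, hc, hlow⟩ := exists_eventually_mul_pow_le_of_renewal
    (a := fun n => (a n : ℝ)) (e := fun n => (e n : ℝ)) M.coe_nonneg (NNReal.coe_lt_coe.2 hML)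
    K.coe_nonneg C.coe_nonneg (v := y) (NNReal.coe_pos.2 (by simpa [pos_iff_ne_zero] using hd))
    (fun m n hmn => NNReal.coe_le_coe.2 (ENNReal.coe_le_coe.1 (hmono hmn)))
    (fun n => by exact_mod_cast hup n)
    (by exact_mod_cast hzero) (fun n => by exact_mod_cast hstep n)
    (fun n => by exact_mod_cast hLv n)
  lift c to NNReal using hc.le
  refine ⟨c, by simpa using hc.ne', ENNReal.coe_ne_top, ?_⟩
  filter_upwards [hlow] with n hn
  exact_mod_cast hn

end IsTabooVector

lemma hasPerronValue_of_exists_mul_pow_le {L : NNReal} (hT : IsTransitiveChain T)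
    (hv : succSum T v = (L : ℝ≥0∞) • v) (hv0 : ∀ u, v u ≠ 0) (hv' : ∀ u, v u ≠ ⊤) (hL : L ≠ 0)
    {d : V} (hd : ∃ c : ℝ≥0∞, c ≠ 0 ∧ c ≠ ⊤ ∧ ∀ᶠ n in atTop, c * L ^ n ≤ pathCount T n d d) :
    HasPerronValue T L := by
  intro u
  obtain ⟨c, hc, hc', hlow⟩ := hd
  obtain ⟨m, -, hm⟩ := hT u d
  obtain ⟨k, -, hk⟩ := hT d u
  have hLpow : (L : ℝ≥0∞) ^ (m + k) ≠ 0 := pow_ne_zero _ (by simpa using hL)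
  have hLpow' : (L : ℝ≥0∞) ^ (m + k) ≠ ⊤ := ENNReal.pow_ne_top ENNReal.coe_ne_top
  refine tendsto_rpow_one_div_of_le_of_le (c := c / L ^ (m + k))
    (ENNReal.div_ne_zero.2 ⟨hc, hLpow'⟩) (ENNReal.div_ne_top hc' hLpow) ENNReal.coe_ne_top ?_
    (pathCount_self_le hv (hv0 u) (hv' u))
  filter_upwards [(tendsto_sub_atTop_nat (m + k)).eventually hlow,
    eventually_ge_atTop (m + k)] with N hN hle
  obtain ⟨n, rfl⟩ := Nat.exists_eq_add_of_le' hle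
  rw [Nat.add_sub_cancel] at hN
  calc c / (L : ℝ≥0∞) ^ (m + k) * L ^ (n + (m + k)) = c * L ^ n := by
        rw [pow_add _ n, mul_comm ((L : ℝ≥0∞) ^ n), ← mul_assoc,
          ENNReal.div_mul_cancel hLpow hLpow']
    _ ≤ 1 * pathCount T n d d * 1 := by simpa using hN
    _ ≤ pathCount T m u d * pathCount T n d d * pathCount T k d u := by
        gcongr <;> exact one_le_pathCount ‹_›
    _ ≤ pathCount T (m + n + k) u u :=
        (mul_le_mul_left (pathCount_mul_pathCount_le m n u d d) _).trans
          (pathCount_mul_pathCount_le (m + n) k u d u)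
    _ = pathCount T (n + (m + k)) u u := by rw [add_comm m, add_assoc]

lemma pathSet_submatrix (e : V' ≃ V) (n : ℕ) (u w : V') :
    pathSet (T.submatrix e e) n u w = (e ∘ ·) ⁻¹' pathSet T n (e u) (e w) := by
  ext p
  simp [pathSet]

lemma loopCount_submatrix (e : V' ≃ V) (u : V') :
    loopCount (T.submatrix e e) u = loopCount T (e u) := by
  funext n
  rw [loopCount, pathSet_submatrix, encard_preimage_of_bijective e.bijective.comp_left, loopCount]

lemma firstReturnCount_submatrix (e : V' ≃ V) (u : V') :
    firstReturnCount (T.submatrix e e) u = firstReturnCount T (e u) := by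
  funext n
  have hpre : {p ∈ pathSet (T.submatrix e e) n u u | ∀ i, i ≠ 0 → i ≠ Fin.last n → p i ≠ u} =
      (e ∘ ·) ⁻¹' {p ∈ pathSet T n (e u) (e u) | ∀ i, i ≠ 0 → i ≠ Fin.last n → p i ≠ e u} := by
    ext p
    simp [pathSet_submatrix]
  rw [firstReturnCount, hpre, encard_preimage_of_bijective e.bijective.comp_left, firstReturnCount]

lemma nonempty_pathSet_submatrix_iff (e : V' ≃ V) {u w : V'} :
    (pathSet (T.submatrix e e) n u w).Nonempty ↔ (pathSet T n (e u) (e w)).Nonempty := by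
  rw [pathSet_submatrix, e.surjective.comp_left.nonempty_preimage]

lemma hasPerronValue_submatrix_iff (e : V' ≃ V) {L : ℝ≥0∞} :
    HasPerronValue (T.submatrix e e) L ↔ HasPerronValue T L := by
  simp only [HasPerronValue, loopCount_submatrix, e.forall_congr_left, e.apply_symm_apply]

lemma isTransitiveChain_submatrix_iff (e : V' ≃ V) :
    IsTransitiveChain (T.submatrix e e) ↔ IsTransitiveChain T := by
  simp only [IsTransitiveChain, nonempty_pathSet_submatrix_iff,
    e.forall_congr_left, e.apply_symm_apply]

lemma isStronglyPositiveRecurrent_submatrix_iff (e : V' ≃ V) :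
    IsStronglyPositiveRecurrent (T.submatrix e e) ↔ IsStronglyPositiveRecurrent T := by
  simp only [IsStronglyPositiveRecurrent, isTransitiveChain_submatrix_iff,
    hasPerronValue_submatrix_iff, firstReturnRate, firstReturnCount_submatrix,
    e.exists_congr_left, e.apply_symm_apply]

lemma isNonnegEigenvector_submatrix_iff (e : V' ≃ V) {l : ℝ} {x : V → ℝ} :
    IsNonnegEigenvector (T.submatrix e e) l (x ∘ e) ↔ IsNonnegEigenvector T l x := by
  refine and_congr ?_ (and_congr ?_ ?_)
  · simp [e.forall_congr_left]
  · simp [funext_iff, e.forall_congr_left]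
  · rw [e.forall_congr_left]
    refine forall_congr' fun u => ?_
    rw [← e.hasSum_iff]
    simp [Function.comp_def]

end Paths

section Eigenvectors

open NNReal

variable {V : Type*} {T : Matrix V V ℝ} {d : V}

lemma hasSum_row_iff_succSum_eq (hT : ∀ u w, T u w = 0 ∨ T u w = 1) {x : V → ℝ≥0} {u : V}
    {r : ℝ≥0} : HasSum (fun w => T u w * x w) r ↔ succSum T (fun w => (x w : ℝ≥0∞)) u = r := by
  have hrow : ∀ w, T u w * x w = ({w | T u w = 1}.indicator x w : ℝ≥0) := fun w => by
    rcases hT u w with h | h <;> simp [h]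
  have hcoe : ∀ w, {w | T u w = 1}.indicator (fun w => (x w : ℝ≥0∞)) w =
      ({w | T u w = 1}.indicator x w : ℝ≥0) := fun w => by
    rcases hT u w with h | h <;> simp [h]
  simp only [hrow, NNReal.hasSum_coe, succSum_apply, hcoe]
  rw [← ENNReal.summable.hasSum_iff, ENNReal.hasSum_coe]

lemma isNonnegEigenvector_coe_iff (hT : ∀ u w, T u w = 0 ∨ T u w = 1) {l : ℝ≥0} {x : V → ℝ≥0} :
    IsNonnegEigenvector T l (fun u => x u) ↔
      x ≠ 0 ∧ succSum T (fun u => (x u : ℝ≥0∞)) = (l : ℝ≥0∞) • fun u => (x u : ℝ≥0∞) := by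
  have hrow : ∀ u, HasSum (fun w => T u w * x w) (l * x u) ↔
      succSum T (fun w => (x w : ℝ≥0∞)) u = l * x u := fun u => by
    exact_mod_cast hasSum_row_iff_succSum_eq hT (r := l * x u)
  simp [IsNonnegEigenvector, funext_iff, hrow]

lemma exists_isNonnegEigenvector_submatrix_iff {V' : Type*} (e : V' ≃ V) {l : ℝ} :
    (∃ x, IsNonnegEigenvector (T.submatrix e e) l x) ↔ ∃ x, IsNonnegEigenvector T l x := by
  simp only [← isNonnegEigenvector_submatrix_iff e]
  exact ((e.arrowCongr (Equiv.refl ℝ)).symm.surjective.exists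
    (p := IsNonnegEigenvector (T.submatrix e e) l))

namespace IsNonnegEigenvector

variable {l : ℝ} {x : V → ℝ} (hx : IsNonnegEigenvector T l x) (hd : ∀ w, T d w = 1)

include hx hd

lemma hasSum_of_row_eq_one : HasSum x (l * x d) := by
  simpa only [hd, one_mul] using hx.2.2 d

lemma pos_of_row_eq_one : 0 < l ∧ 0 < x d := by
  have hsum := hx.hasSum_of_row_eq_one hd
  obtain ⟨u, hu⟩ := Function.ne_iff.1 hx.2.1
  have hpos : 0 < l * x d :=
    ((hx.1 u).lt_of_ne' hu).trans_le (le_hasSum hsum u fun w _ => hx.1 w)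
  have hxd : 0 < x d := (hx.1 d).lt_of_ne' (right_ne_zero_of_mul hpos.ne')
  exact ⟨pos_of_mul_pos_left hpos hxd.le, hxd⟩

lemma le_of_mul_pow_le_pathCount (hT : ∀ u w, T u w = 0 ∨ T u w = 1) {L : ℝ≥0}
    (hL : ∃ c : ℝ≥0∞, c ≠ 0 ∧ c ≠ ⊤ ∧ ∀ᶠ n in atTop, c * L ^ n ≤ pathCount T n d d) : L ≤ l := by
  obtain ⟨hl, hxd⟩ := hx.pos_of_row_eq_one hd
  obtain ⟨c, hc, hc', hlow⟩ := hL
  lift x to V → ℝ≥0 using hx.1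
  lift l to ℝ≥0 using hl.le
  have hv := ((isNonnegEigenvector_coe_iff hT).1 hx).2
  have hup := pathCount_self_le hv (u := d) (ENNReal.coe_ne_zero.2 (NNReal.coe_pos.1 hxd).ne')
    ENNReal.coe_ne_top
  have hlim := tendsto_const_mul_pow_rpow_one_div hc hc' (ENNReal.coe_ne_top (r := L))
  have hlim' := tendsto_const_mul_pow_rpow_one_div one_ne_zero ENNReal.one_ne_top
    (ENNReal.coe_ne_top (r := l))
  have hle : (L : ℝ≥0∞) ≤ l := by
    refine le_of_tendsto_of_tendsto hlim hlim' ?_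
    filter_upwards [hlow] with n hn
    exact ENNReal.rpow_le_rpow ((hn.trans (hup n)).trans_eq (one_mul _).symm) (by positivity)
  exact_mod_cast hle

end IsNonnegEigenvector

end Eigenvectors

/-! ### Markov schemes and their grids -/

section Schemes

open MeasureTheory

/-- The combinatorics of a Markov map of an interval: `P` is the ordered set of partition points,
`V` labels the gaps `(lo X, hi X)` of `P`, and `step` is the dynamics on the partition points. The
map itself is thought of as monotone on each gap. -/
structure MarkovScheme (V P : Type*) [LinearOrder P] where
  lo : V → P
  hi : V → P
  step : P → P
  lo_covBy_hi : ∀ X, lo X ⋖ hi X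
  lo_injective : lo.Injective

namespace MarkovScheme

variable {V P : Type*} [LinearOrder P] (S : MarkovScheme V P)

/-- The image of the gap `X`, which lies between the images of its endpoints, contains the
gap `Y`. -/
def Covers (X Y : V) : Prop := Icc (S.lo Y) (S.hi Y) ⊆ uIcc (S.step (S.lo X)) (S.step (S.hi X))

open Classical in
/-- The 0-1 matrix of the covering relation. -/
noncomputable def matrix : Matrix V V ℝ := fun X Y => if S.Covers X Y then 1 else 0

variable {S}

lemma matrix_eq_one_iff {X Y : V} : S.matrix X Y = 1 ↔ S.Covers X Y := by simp [matrix]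

lemma hi_le_lo_of_lo_lt_lo {X Y : V} (h : S.lo X < S.lo Y) : S.hi X ≤ S.lo Y :=
  (S.lo_covBy_hi X).ge_of_gt h

lemma hi_le_lo_or_eq_or_hi_le_lo (X Y : V) : S.hi X ≤ S.lo Y ∨ X = Y ∨ S.hi Y ≤ S.lo X := by
  rcases lt_trichotomy (S.lo X) (S.lo Y) with h | h | h
  · exact .inl (hi_le_lo_of_lo_lt_lo h)
  · exact .inr (.inl (S.lo_injective h))
  · exact .inr (.inr (hi_le_lo_of_lo_lt_lo h))

lemma le_lo_or_hi_le (t : P) (X : V) : t ≤ S.lo X ∨ S.hi X ≤ t :=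
  (le_or_gt t (S.lo X)).imp_right (S.lo_covBy_hi X).ge_of_gt

lemma Icc_subset_uIcc_or_hi_le_or_le_lo (X : V) (s t : P) :
    Icc (S.lo X) (S.hi X) ⊆ uIcc s t ∨ S.hi X ≤ s ⊓ t ∨ s ⊔ t ≤ S.lo X := by
  rcases le_lo_or_hi_le (s ⊓ t) X with h | h
  · rcases le_lo_or_hi_le (s ⊔ t) X with h' | h'
    · exact .inr (.inr h')
    · exact .inl (Icc_subset_Icc h h')
  · exact .inr (.inl h)

variable (S) in
/-- Positions in the unit interval for the partition points of a Markov scheme, such that the gaps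
are all that is missing. -/
structure Grid [BoundedOrder P] where
  point : P → Icc (0 : ℝ) 1
  strictMono : StrictMono point
  point_bot : point ⊥ = 0
  point_top : point ⊤ = 1
  exists_eq_point_or_mem_Ioo :
    ∀ x, (∃ t, x = point t) ∨ ∃ X, x ∈ Ioo (point (S.lo X)) (point (S.hi X))

namespace Grid

variable [BoundedOrder P] (G : S.Grid)

/-- The open subinterval between two neighbouring partition points. -/
def cell (X : V) : Set (Icc (0 : ℝ) 1) := Ioo (G.point (S.lo X)) (G.point (S.hi X))

/-- The closed subinterval between two neighbouring partition points. -/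
def closedCell (X : V) : Set (Icc (0 : ℝ) 1) := Icc (G.point (S.lo X)) (G.point (S.hi X))

lemma cell_subset_closedCell (X : V) : G.cell X ⊆ G.closedCell X := Ioo_subset_Icc_self

lemma point_lo_lt (X : V) : G.point (S.lo X) < G.point (S.hi X) :=
  G.strictMono (S.lo_covBy_hi X).lt

lemma point_lo_mem (X : V) : G.point (S.lo X) ∈ G.closedCell X :=
  left_mem_Icc.2 (G.point_lo_lt X).le

lemma point_hi_mem (X : V) : G.point (S.hi X) ∈ G.closedCell X :=
  right_mem_Icc.2 (G.point_lo_lt X).le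

lemma point_mem_closedCell_iff {t : P} {X : V} :
    G.point t ∈ G.closedCell X ↔ t ∈ Icc (S.lo X) (S.hi X) :=
  and_congr G.strictMono.le_iff_le G.strictMono.le_iff_le

lemma cell_nonempty (X : V) : (G.cell X).Nonempty := nonempty_Ioo.2 (G.point_lo_lt X)

lemma lt_of_hi_le_lo {X Y : V} (h : S.hi X ≤ S.lo Y) {x y : Icc (0 : ℝ) 1}
    (hx : x ∈ G.cell X) (hy : y ∈ G.cell Y) : x < y :=
  (hx.2.trans_le (G.strictMono.monotone h)).trans hy.1

lemma eq_of_mem_cell_of_mem_closedCell {X Y : V} {x : Icc (0 : ℝ) 1} (hX : x ∈ G.cell X)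
    (hY : x ∈ G.closedCell Y) : X = Y := by
  rcases S.hi_le_lo_or_eq_or_hi_le_lo X Y with h | h | h
  · exact absurd (hX.2.trans_le (G.strictMono.monotone h)) hY.1.not_gt
  · exact h
  · exact absurd ((G.strictMono.monotone h).trans_lt hX.1) hY.2.not_gt

lemma pairwise_disjoint_cell : Pairwise (Function.onFun Disjoint G.cell) := fun _ _ hXY =>
  disjoint_left.2 fun _ hX hY =>
    hXY (G.eq_of_mem_cell_of_mem_closedCell hX (G.cell_subset_closedCell _ hY))

lemma cell_injective : Function.Injective G.cell := fun X Y h =>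
  let ⟨_, hx⟩ := G.cell_nonempty X
  G.eq_of_mem_cell_of_mem_closedCell hx (G.cell_subset_closedCell Y (h ▸ hx))

lemma point_notMem_cell (t : P) (X : V) : G.point t ∉ G.cell X := fun h =>
  (le_lo_or_hi_le t X).elim (fun ht => h.1.not_ge (G.strictMono.monotone ht))
    fun ht => h.2.not_ge (G.strictMono.monotone ht)

lemma cell_subset_uIoo_iff {X : V} {s t : P} :
    G.cell X ⊆ uIoo (G.point s) (G.point t) ↔ Icc (S.lo X) (S.hi X) ⊆ uIcc s t := by
  rw [cell, uIoo, ← G.strictMono.monotone.map_inf, ← G.strictMono.monotone.map_sup,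
    Ioo_subset_Ioo_iff (G.point_lo_lt X), uIcc, Icc_subset_Icc_iff (S.lo_covBy_hi X).le,
    G.strictMono.le_iff_le, G.strictMono.le_iff_le]

lemma cell_subset_uIoo_of_mem {X : V} {s t : P} {x : Icc (0 : ℝ) 1} (hx : x ∈ G.cell X)
    (hx' : x ∈ uIoo (G.point s) (G.point t)) : Icc (S.lo X) (S.hi X) ⊆ uIcc s t := by
  rw [uIoo, ← G.strictMono.monotone.map_inf, ← G.strictMono.monotone.map_sup] at hx'
  rcases S.Icc_subset_uIcc_or_hi_le_or_le_lo X s t with h | h | h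
  · exact h
  · exact absurd (hx'.1.trans hx.2) (G.strictMono.monotone h).not_gt
  · exact absurd (hx.1.trans hx'.2) (G.strictMono.monotone h).not_gt

/-- The set of all partition points. -/
def partition : Set (Icc (0 : ℝ) 1) := range G.point

lemma mem_partition_or_mem_cell (x : Icc (0 : ℝ) 1) : x ∈ G.partition ∨ ∃ X, x ∈ G.cell X :=
  (G.exists_eq_point_or_mem_Ioo x).imp_left fun ⟨t, ht⟩ => ⟨t, ht.symm⟩

lemma compl_partition : G.partitionᶜ = ⋃ X, G.cell X := by
  ext x
  rw [mem_iUnion, mem_compl_iff]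
  refine ⟨(G.mem_partition_or_mem_cell x).resolve_left, ?_⟩
  rintro ⟨X, hX⟩ ⟨t, rfl⟩
  exact G.point_notMem_cell t X hX

lemma notMem_partition_iff {x : Icc (0 : ℝ) 1} : x ∉ G.partition ↔ ∃ X, x ∈ G.cell X := by
  rw [← mem_compl_iff, compl_partition, mem_iUnion]

lemma isClosed_partition : IsClosed G.partition := by
  rw [← isOpen_compl_iff, compl_partition]
  exact isOpen_iUnion fun _ => isOpen_Ioo

lemma subset_cell_of_ordConnected {X : V} {J : Set (Icc (0 : ℝ) 1)} (hJ : J.OrdConnected)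
    (hJp : J ⊆ G.partitionᶜ) {x : Icc (0 : ℝ) 1} (hx : x ∈ G.cell X) (hxJ : x ∈ J) :
    J ⊆ G.cell X := by
  have hnot : ∀ t, G.point t ∉ J := fun t ht => hJp ht (mem_range_self t)
  refine fun y hy => ⟨?_, ?_⟩
  · by_contra! h
    exact hnot _ (hJ.out hy hxJ ⟨h, hx.1.le⟩)
  · by_contra! h
    exact hnot _ (hJ.out hxJ hy ⟨hx.2.le, h⟩)

lemma connectedComponentIn_compl_partition {X : V} {x : Icc (0 : ℝ) 1} (hx : x ∈ G.cell X) :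
    connectedComponentIn G.partitionᶜ x = G.cell X := by
  have hcell : G.cell X ⊆ G.partitionᶜ := G.compl_partition ▸ subset_iUnion G.cell X
  exact Subset.antisymm
    (G.subset_cell_of_ordConnected isPreconnected_connectedComponentIn.ordConnected
      (connectedComponentIn_subset _ _) hx (mem_connectedComponentIn (hcell hx)))
    (isPreconnected_Ioo.subset_connectedComponentIn hx hcell)

lemma isBasicInterval_partition_iff (J : Set (Icc (0 : ℝ) 1)) :
    IsBasicInterval G.partition J ↔ ∃ X, J = G.cell X := by
  constructor
  · rintro ⟨x, hx, rfl⟩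
    obtain ⟨X, hX⟩ := G.notMem_partition_iff.1 hx
    exact ⟨X, G.connectedComponentIn_compl_partition hX⟩
  · rintro ⟨X, rfl⟩
    obtain ⟨x, hx⟩ := G.cell_nonempty X
    exact ⟨x, G.notMem_partition_iff.2 ⟨X, hx⟩, (G.connectedComponentIn_compl_partition hx).symm⟩

/-- The cells as the basic intervals of the partition. -/
noncomputable def cellEquiv : V ≃ BasicInterval G.partition :=
  Equiv.ofBijective
    (fun X => ⟨G.cell X, (G.isBasicInterval_partition_iff _).2 ⟨X, rfl⟩⟩)
    ⟨fun _ _ h => G.cell_injective (congrArg Subtype.val h), fun J =>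
      let ⟨X, hX⟩ := (G.isBasicInterval_partition_iff J.1).1 J.2
      ⟨X, Subtype.ext hX.symm⟩⟩

lemma diam_cell (X : V) :
    Metric.diam (G.cell X) = (G.point (S.hi X) : ℝ) - G.point (S.lo X) := by
  rw [← isometry_subtype_coe.diam_image, cell, image_subtype_val_Ioo,
    Real.diam_Ioo (G.point_lo_lt X).le]

lemma edist_point (X : V) :
    edist (G.point (S.hi X)) (G.point (S.lo X)) = ENNReal.ofReal (Metric.diam (G.cell X)) := by
  rw [G.diam_cell, edist_dist, Subtype.dist_eq, Real.dist_eq,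
    abs_of_pos (sub_pos.2 (Subtype.coe_lt_coe.2 (G.point_lo_lt X)))]

lemma diam_cell_pos (X : V) : 0 < Metric.diam (G.cell X) := by
  rw [diam_cell]
  exact sub_pos.2 (G.point_lo_lt X)

/-- Both sides are the Lebesgue measure of the interval between the images of the endpoints of `X`,
the partition points being negligible. -/
lemma succSum_diam_cell [Countable P] (X : V) :
    succSum S.matrix (fun Y => ENNReal.ofReal (Metric.diam (G.cell Y))) X =
      edist (G.point (S.step (S.hi X))) (G.point (S.step (S.lo X))) := by
  have : Countable V := S.lo_injective.countable
  set K := uIoo (G.point (S.step (S.lo X))) (G.point (S.step (S.hi X)))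
  have hinter : ∀ Y, volume (K ∩ G.cell Y) =
      {Y | S.Covers X Y}.indicator (fun Y => ENNReal.ofReal (Metric.diam (G.cell Y))) Y := by
    intro Y
    by_cases hY : S.Covers X Y
    · rw [inter_eq_right.2 (G.cell_subset_uIoo_iff.2 hY), indicator_of_mem
        (mem_ofPred.2 hY), ← G.edist_point, ← unitInterval.volume_uIoo, cell,
        uIoo_of_lt (G.point_lo_lt Y)]
    · rw [indicator_of_notMem (mt mem_ofPred.1 hY), disjoint_iff_inter_eq_empty.1
        (disjoint_left.2 fun x hxK hx => hY (G.cell_subset_uIoo_of_mem hx hxK)), measure_empty]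
  have hnull : volume G.partition = 0 := (countable_range G.point).measure_zero _
  calc succSum S.matrix (fun Y => ENNReal.ofReal (Metric.diam (G.cell Y))) X
      = ∑' Y, volume (K ∩ G.cell Y) := by simp only [hinter, succSum_apply, matrix_eq_one_iff]
    _ = volume (K ∩ G.partitionᶜ) := by
      rw [compl_partition, inter_iUnion, measure_iUnion]
      · exact fun Y Z hYZ => (G.pairwise_disjoint_cell hYZ).mono inter_subset_right
          inter_subset_right
      · exact fun Y => measurableSet_Ioo.inter measurableSet_Ioo
    _ = volume K := measure_inter_conull (by rwa [compl_compl])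
    _ = _ := unitInterval.volume_uIoo _ _

end Grid

end MarkovScheme

end Schemes

/-! ### Maps of constant slope following a Markov scheme -/

section Models

open NNReal

lemma sub_eq_of_lipschitzWith {s : Set ℝ} {g : s → s} {K : ℝ≥0} (hg : LipschitzWith K g)
    {a b x y : s} (hab : a < b) (h : dist (g a) (g b) = K * dist a b) (hx : x ∈ Icc a b)
    (hy : y ∈ Icc a b) :
    (g y : ℝ) - g x = ((g b : ℝ) - g a) / ((b : ℝ) - a) * ((y : ℝ) - x) := by
  have hpos : 0 < (b : ℝ) - a := sub_pos.2 hab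
  have hchord : ∀ z ∈ Icc a b,
      ((g z : ℝ) - g a) * ((b : ℝ) - a) = ((g b : ℝ) - g a) * ((z : ℝ) - a) := by
    intro z hz
    have haz := abs_le.1 ((hg.dist_le_mul z a).trans_eq (by
      rw [Subtype.dist_eq, Real.dist_eq, abs_of_nonneg (sub_nonneg.2 (Subtype.coe_le_coe.2 hz.1))]))
    have hzb := abs_le.1 ((hg.dist_le_mul b z).trans_eq (by
      rw [Subtype.dist_eq, Real.dist_eq, abs_of_nonneg (sub_nonneg.2 (Subtype.coe_le_coe.2 hz.2))]))
    rw [dist_comm, dist_comm a, Subtype.dist_eq, Subtype.dist_eq, Real.dist_eq, Real.dist_eq,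
      abs_of_pos hpos] at h
    rcases abs_choice ((g b : ℝ) - g a) with hs | hs <;> rw [hs] at h
    · have : (g z : ℝ) - g a = K * ((z : ℝ) - a) := by linarith
      rw [this, h]
      ring
    · have : (g z : ℝ) - g a = -(K * ((z : ℝ) - a)) := by linarith
      rw [this, ← neg_eq_iff_eq_neg.2 h.symm]
      ring
  rw [div_mul_eq_mul_div, eq_div_iff hpos.ne']
  linear_combination hchord y hy - hchord x hx

lemma uIcc_sdiff_both {α : Type*} [LinearOrder α] (a b : α) :
    uIcc a b \ {a, b} = uIoo a b := by
  rcases le_total a b with h | h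
  · rw [uIcc_of_le h, uIoo_of_le h, Icc_sdiff_both]
  · rw [uIcc_of_ge h, uIoo_of_ge h, pair_comm, Icc_sdiff_both]

namespace MarkovScheme

variable {V P : Type*} [LinearOrder P] [BoundedOrder P] (S : MarkovScheme V P)

/-- A grid on which the dynamics of a Markov scheme stretches every gap by the factor `slope`. -/
structure Model extends S.Grid where
  slope : ℝ≥0
  one_lt_slope : 1 < slope
  dist_point_step : ∀ X, dist (point (S.step (S.lo X))) (point (S.step (S.hi X))) =
    slope * dist (point (S.lo X)) (point (S.hi X))
  dist_point_step_le : ∀ s t, dist (point (S.step s)) (point (S.step t)) ≤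
    slope * dist (point s) (point t)

namespace Model

variable {S} (M : S.Model)

lemma slope_pos : 0 < M.slope := zero_lt_one.trans M.one_lt_slope

lemma exists_lipschitzWith_apply_point : ∃ f : Icc (0 : ℝ) 1 → Icc (0 : ℝ) 1,
    LipschitzWith M.slope f ∧ ∀ t, f (M.point t) = M.point (S.step t) := by
  let φ : Icc (0 : ℝ) 1 → ℝ := fun x => M.point (S.step (Function.invFun M.point x))
  have hφ : ∀ t, φ (M.point t) = M.point (S.step t) := fun t => by
    simp only [φ, Function.leftInverse_invFun M.strictMono.injective t]
  have hLip : LipschitzOnWith M.slope φ (range M.point) := by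
    refine LipschitzOnWith.of_dist_le_mul ?_
    rintro _ ⟨s, rfl⟩ _ ⟨t, rfl⟩
    rw [hφ, hφ]
    exact M.dist_point_step_le s t
  obtain ⟨g, hg, hgφ⟩ := hLip.extend_real
  refine ⟨fun x => projIcc 0 1 zero_le_one (g x), ?_, fun t => ?_⟩
  · exact one_mul M.slope ▸ (LipschitzWith.projIcc zero_le_one).comp hg
  · change projIcc 0 1 zero_le_one (g (M.point t)) = _
    rw [← hgφ (mem_range_self t), hφ, projIcc_val]

/-- The map of a model: a `slope`-Lipschitz extension of the dynamics on the partition points. Since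
the endpoints of a cell are stretched by exactly the Lipschitz constant, it has to be affine
there. -/
noncomputable def map : Icc (0 : ℝ) 1 → Icc (0 : ℝ) 1 := M.exists_lipschitzWith_apply_point.choose

lemma lipschitzWith_map : LipschitzWith M.slope M.map :=
  M.exists_lipschitzWith_apply_point.choose_spec.1

lemma continuous_map : Continuous M.map := M.lipschitzWith_map.continuous

lemma map_point (t : P) : M.map (M.point t) = M.point (S.step t) :=
  M.exists_lipschitzWith_apply_point.choose_spec.2 t

/-- The signed slope of the map on a cell. -/
noncomputable def signedSlope (X : V) : ℝ :=
  ((M.point (S.step (S.hi X)) : ℝ) - M.point (S.step (S.lo X))) /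
    ((M.point (S.hi X) : ℝ) - M.point (S.lo X))

lemma map_sub_map {X : V} {x y : Icc (0 : ℝ) 1} (hx : x ∈ M.closedCell X)
    (hy : y ∈ M.closedCell X) :
    (M.map y : ℝ) - M.map x = M.signedSlope X * ((y : ℝ) - x) := by
  rw [sub_eq_of_lipschitzWith M.lipschitzWith_map (M.point_lo_lt X)
    (by simpa only [map_point] using M.dist_point_step X) hx hy, map_point, map_point, signedSlope]

lemma abs_signedSlope (X : V) : |M.signedSlope X| = M.slope := by
  have h := M.dist_point_step X
  rw [dist_comm, dist_comm (M.point (S.lo X)), Subtype.dist_eq, Subtype.dist_eq] at h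
  rw [signedSlope, abs_div,
    div_eq_iff (abs_pos.2 (sub_ne_zero.2 (Subtype.coe_injective.ne (M.point_lo_lt X).ne'))).ne']
  exact h

lemma signedSlope_pos {X : V} (h : S.step (S.lo X) < S.step (S.hi X)) : 0 < M.signedSlope X :=
  div_pos (sub_pos.2 (M.strictMono h)) (sub_pos.2 (M.point_lo_lt X))

lemma signedSlope_neg {X : V} (h : S.step (S.hi X) < S.step (S.lo X)) : M.signedSlope X < 0 :=
  div_neg_of_neg_of_pos (sub_neg.2 (M.strictMono h)) (sub_pos.2 (M.point_lo_lt X))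

lemma dist_map {X : V} {x y : Icc (0 : ℝ) 1} (hx : x ∈ M.closedCell X)
    (hy : y ∈ M.closedCell X) : dist (M.map x) (M.map y) = M.slope * dist x y := by
  rw [Subtype.dist_eq, Subtype.dist_eq, Real.dist_eq, Real.dist_eq, M.map_sub_map hy hx, abs_mul,
    abs_signedSlope]

lemma injOn_map (X : V) : InjOn M.map (M.closedCell X) := fun x hx y hy h => by
  have hdist := M.dist_map hx hy
  rw [h, dist_self, zero_eq_mul] at hdist
  exact dist_eq_zero.1 (hdist.resolve_left (NNReal.coe_pos.2 M.slope_pos).ne')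

lemma strictMonoOn_map {X : V} (h : S.step (S.lo X) < S.step (S.hi X)) :
    StrictMonoOn M.map (M.closedCell X) := fun _ hx _ hy hxy =>
  Subtype.coe_lt_coe.1 (sub_pos.1 (M.map_sub_map hx hy ▸
    mul_pos (M.signedSlope_pos h) (sub_pos.2 (Subtype.coe_lt_coe.2 hxy))))

lemma strictAntiOn_map {X : V} (h : S.step (S.hi X) < S.step (S.lo X)) :
    StrictAntiOn M.map (M.closedCell X) := fun _ hx _ hy hxy =>
  Subtype.coe_lt_coe.1 (sub_neg.1 (M.map_sub_map hx hy ▸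
    mul_neg_of_neg_of_pos (M.signedSlope_neg h) (sub_pos.2 (Subtype.coe_lt_coe.2 hxy))))

include M in
lemma step_lo_ne_step_hi (X : V) : S.step (S.lo X) ≠ S.step (S.hi X) := fun h => by
  have hends := M.injOn_map X (M.point_lo_mem X) (M.point_hi_mem X)
    (by rw [map_point, map_point, h])
  exact (M.point_lo_lt X).ne hends

lemma strictMonoOn_or_strictAntiOn_map (X : V) :
    StrictMonoOn M.map (M.closedCell X) ∨ StrictAntiOn M.map (M.closedCell X) :=
  (M.step_lo_ne_step_hi X).lt_or_gt.imp M.strictMonoOn_map M.strictAntiOn_map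

lemma mapsTo_map_closedCell (X : V) : MapsTo M.map (M.closedCell X)
    (uIcc (M.point (S.step (S.lo X))) (M.point (S.step (S.hi X)))) := by
  intro x hx
  have hlo := M.point_lo_mem X
  have hhi := M.point_hi_mem X
  rw [← map_point, ← map_point, mem_uIcc]
  rcases M.strictMonoOn_or_strictAntiOn_map X with h | h
  · exact .inl ⟨h.monotoneOn hlo hx hx.1, h.monotoneOn hx hhi hx.2⟩
  · exact .inr ⟨h.antitoneOn hx hhi hx.2, h.antitoneOn hlo hx hx.1⟩

lemma image_closedCell (X : V) : M.map '' M.closedCell X =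
    uIcc (M.point (S.step (S.lo X))) (M.point (S.step (S.hi X))) := by
  refine (M.mapsTo_map_closedCell X).image_subset.antisymm ?_
  have hivt := intermediate_value_uIcc (f := M.map) (a := M.point (S.lo X))
    (b := M.point (S.hi X)) M.continuous_map.continuousOn
  rwa [map_point, map_point, uIcc_of_lt (M.point_lo_lt X)] at hivt

lemma image_cell (X : V) : M.map '' M.cell X =
    uIoo (M.point (S.step (S.lo X))) (M.point (S.step (S.hi X))) := by
  have hends : {M.point (S.lo X), M.point (S.hi X)} ⊆ M.closedCell X :=
    pair_subset (M.point_lo_mem X) (M.point_hi_mem X)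
  rw [Grid.cell, ← Icc_sdiff_both, ← Grid.closedCell, (M.injOn_map X).image_sdiff_subset hends,
    image_closedCell, image_pair, map_point, map_point, uIcc_sdiff_both]

lemma cell_subset_image_iff (X Y : V) : M.cell Y ⊆ M.map '' M.cell X ↔ S.Covers X Y := by
  rw [image_cell, M.cell_subset_uIoo_iff, Covers]

lemma covers_of_mem_cell {X Y : V} {x : Icc (0 : ℝ) 1} (hx : x ∈ M.cell X)
    (hy : M.map x ∈ M.cell Y) : S.Covers X Y :=
  M.cell_subset_uIoo_of_mem hy (M.image_cell X ▸ mem_image_of_mem _ hx)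

lemma mapsTo_map_partition : MapsTo M.map M.partition M.partition := by
  rintro _ ⟨t, rfl⟩
  exact ⟨S.step t, (M.map_point t).symm⟩

lemma isCPMM [Countable P] : IsCPMM M.map M.partition where
  lt := zero_lt_one
  continuous := M.continuous_map
  isClosed := M.isClosed_partition
  countable := countable_range _
  left_mem _ hx := ⟨⊥, M.point_bot.trans (Subtype.ext hx.symm)⟩
  right_mem _ hx := ⟨⊤, M.point_top.trans (Subtype.ext hx.symm)⟩
  mapsTo := M.mapsTo_map_partition
  monotone J hJ := by
    obtain ⟨X, rfl⟩ := (M.isBasicInterval_partition_iff J).1 hJ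
    exact (M.strictMonoOn_or_strictAntiOn_map X).imp
      (fun h => (h.mono (M.cell_subset_closedCell X)).monotoneOn)
      fun h => (h.mono (M.cell_subset_closedCell X)).antitoneOn

lemma hasConstantSlope : HasConstantSlope M.map M.partition M.slope := by
  intro J hJ
  obtain ⟨X, rfl⟩ := (M.isBasicInterval_partition_iff J).1 hJ
  refine ⟨M.signedSlope X, M.map (M.point (S.lo X)) - M.signedSlope X * M.point (S.lo X),
    M.abs_signedSlope X, fun x hx => ?_⟩
  linear_combination M.map_sub_map (M.point_lo_mem X) (M.cell_subset_closedCell X hx)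

lemma transitionMatrix_submatrix :
    (transitionMatrix M.map M.partition).submatrix M.cellEquiv M.cellEquiv = S.matrix := by
  ext X Y
  simp only [Matrix.submatrix_apply, transitionMatrix, matrix]
  congr 1
  exact propext (M.cell_subset_image_iff X Y)

lemma succSum_diam_cell [Countable P] :
    succSum S.matrix (fun X => ENNReal.ofReal (Metric.diam (M.cell X))) =
      (M.slope : ℝ≥0∞) • fun X => ENNReal.ofReal (Metric.diam (M.cell X)) := by
  ext X
  rw [M.toGrid.succSum_diam_cell, edist_comm, edist_dist, M.dist_point_step,
    ENNReal.ofReal_mul (NNReal.coe_nonneg _), ENNReal.ofReal_coe_nnreal, ← edist_dist, edist_comm,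
    M.edist_point]
  rfl

end Model

end MarkovScheme

end Models

/-! ### Conjugacy of maps with the same Markov scheme -/

section Conjugacy

open NNReal

variable {X Y : Type*} [MetricSpace Y] {f : X → X} {r C : ℝ}

lemma dist_le_mul_pow_of_dist_le_mul_dist_comp {Ψ Φ : ℕ → X → Y} (hr : 0 ≤ r)
    (h₀ : ∀ x, dist (Ψ 0 x) (Φ 0 x) ≤ C)
    (h : ∀ n x, dist (Ψ (n + 1) x) (Φ (n + 1) x) ≤ r * dist (Ψ n (f x)) (Φ n (f x))) (n : ℕ)
    (x : X) : dist (Ψ n x) (Φ n x) ≤ C * r ^ n := by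
  induction n generalizing x with
  | zero => simpa using h₀ x
  | succ n ih =>
    calc dist (Ψ (n + 1) x) (Φ (n + 1) x) ≤ r * dist (Ψ n (f x)) (Φ n (f x)) := h n x
      _ ≤ r * (C * r ^ n) := by gcongr; exact ih (f x)
      _ = C * r ^ (n + 1) := by ring

lemma exists_tendsto_of_dist_le_mul_dist_comp [CompleteSpace Y] {Ψ : ℕ → X → Y} (hr : 0 ≤ r)
    (hr' : r < 1) (h₀ : ∀ x, dist (Ψ 0 x) (Ψ 1 x) ≤ C)
    (h : ∀ n x, dist (Ψ (n + 1) x) (Ψ (n + 2) x) ≤ r * dist (Ψ n (f x)) (Ψ (n + 1) (f x))) :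
    ∃ ψ : X → Y, ∀ x, Tendsto (Ψ · x) atTop (𝓝 (ψ x)) := by
  have hcauchy : ∀ x, CauchySeq (Ψ · x) := fun x => cauchySeq_of_le_geometric r C hr' fun n =>
    dist_le_mul_pow_of_dist_le_mul_dist_comp (Φ := fun n => Ψ (n + 1)) hr h₀ h n x
  choose ψ hψ using fun x => cauchySeq_tendsto_of_complete (hcauchy x)
  exact ⟨ψ, hψ⟩

lemma eq_of_dist_le_mul_dist_comp {ψ φ : X → Y} (hr : 0 ≤ r) (hr' : r < 1)
    (h₀ : ∀ x, dist (ψ x) (φ x) ≤ C)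
    (h : ∀ x, dist (ψ x) (φ x) ≤ r * dist (ψ (f x)) (φ (f x))) : ψ = φ := by
  ext x
  have hle := dist_le_mul_pow_of_dist_le_mul_dist_comp (Ψ := fun _ => ψ) (Φ := fun _ => φ) hr h₀
    (fun _ => h)
  have hlim : Tendsto (fun n => C * r ^ n) atTop (𝓝 0) := by
    simpa using (tendsto_pow_atTop_nhds_zero_of_lt_one hr hr').const_mul C
  exact dist_le_zero.1 (ge_of_tendsto' hlim fun n => hle n x)

end Conjugacy

namespace MarkovScheme

variable {V P : Type*} [LinearOrder P] [BoundedOrder P] {S : MarkovScheme V P}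

lemma Grid.exists_point_mem_Icc_or_mem_cell (G : S.Grid) {x y : Icc (0 : ℝ) 1} (hxy : x ≤ y) :
    (∃ t, G.point t ∈ Icc x y) ∨ ∃ X, x ∈ G.cell X ∧ y ∈ G.cell X := by
  rcases G.exists_eq_point_or_mem_Ioo x with ⟨t, rfl⟩ | ⟨X, hx⟩
  · exact .inl ⟨t, left_mem_Icc.2 hxy⟩
  · rcases le_or_gt (G.point (S.hi X)) y with hy | hy
    · exact .inl ⟨S.hi X, hx.2.le, hy⟩
    · exact .inr ⟨X, hx, hx.1.trans_le hxy, hy⟩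

/-- A monotone map of the unit interval taking the points of one grid to those of another. -/
structure IsMatching (M N : S.Grid) (ψ : Icc (0 : ℝ) 1 → Icc (0 : ℝ) 1) : Prop where
  monotone : Monotone ψ
  apply_point : ∀ t, ψ (M.point t) = N.point t

lemma exists_isMatching (M N : S.Grid) : ∃ ψ, IsMatching M N ψ := by
  refine ⟨fun x => sSup (N.point '' {t | M.point t ≤ x}), fun x y hxy => ?_, fun t => ?_⟩
  · exact sSup_le_sSup (image_mono fun t ht => le_trans ht hxy)
  · refine IsGreatest.csSup_eq ⟨⟨t, le_refl (M.point t), rfl⟩, ?_⟩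
    rintro _ ⟨s, hs, rfl⟩
    exact N.strictMono.monotone (M.strictMono.le_iff_le.1 hs)

namespace IsMatching

variable {M N K : S.Grid} {ψ φ : Icc (0 : ℝ) 1 → Icc (0 : ℝ) 1}

lemma id : IsMatching M M id := ⟨monotone_id, fun _ => rfl⟩

lemma comp (hφ : IsMatching N K φ) (hψ : IsMatching M N ψ) : IsMatching M K (φ ∘ ψ) :=
  ⟨hφ.monotone.comp hψ.monotone, fun t => by
    rw [Function.comp_apply, hψ.apply_point, hφ.apply_point]⟩

lemma mapsTo_uIcc (hψ : IsMatching M N ψ) (s t : P) :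
    MapsTo ψ (uIcc (M.point s) (M.point t)) (uIcc (N.point s) (N.point t)) := by
  simpa only [hψ.apply_point] using hψ.monotone.mapsTo_uIcc (a := M.point s) (b := M.point t)

lemma mapsTo_closedCell (hψ : IsMatching M N ψ) (X : V) :
    MapsTo ψ (M.closedCell X) (N.closedCell X) := by
  simpa only [hψ.apply_point, Grid.closedCell] using hψ.monotone.mapsTo_Icc
    (a := M.point (S.lo X)) (b := M.point (S.hi X))

lemma tendsto {Ψ : ℕ → Icc (0 : ℝ) 1 → Icc (0 : ℝ) 1} (hΨ : ∀ n, IsMatching M N (Ψ n))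
    (hψ : ∀ x, Tendsto (Ψ · x) atTop (𝓝 (ψ x))) : IsMatching M N ψ where
  monotone x y hxy := le_of_tendsto_of_tendsto' (hψ x) (hψ y) fun n => (hΨ n).monotone hxy
  apply_point t := tendsto_nhds_unique (hψ _)
    (by simp only [(hΨ _).apply_point, tendsto_const_nhds])

end IsMatching

namespace Model

variable {M N : S.Model} {ψ φ : Icc (0 : ℝ) 1 → Icc (0 : ℝ) 1}

lemma exists_lift_apply (hψ : IsMatching M.toGrid N.toGrid ψ) (x : Icc (0 : ℝ) 1) :
    ∃ y, (∀ t, x ≤ M.point t → y ≤ N.point t) ∧ (∀ t, M.point t ≤ x → N.point t ≤ y) ∧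
      N.map y = ψ (M.map x) := by
  have hpoint : ∀ {s t}, M.point s ≤ M.point t → N.point s ≤ N.point t := fun h =>
    N.strictMono.monotone (M.strictMono.le_iff_le.1 h)
  rcases M.exists_eq_point_or_mem_Ioo x with ⟨s, rfl⟩ | ⟨X, hx⟩
  · exact ⟨N.point s, fun _ => hpoint, fun _ => hpoint, by
      rw [map_point, map_point, hψ.apply_point]⟩
  · have himage : ψ (M.map x) ∈ N.map '' N.closedCell X := by
      rw [image_closedCell]
      exact hψ.mapsTo_uIcc _ _ (M.mapsTo_map_closedCell X (M.cell_subset_closedCell X hx))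
    obtain ⟨y, hy, hyx⟩ := himage
    refine ⟨y, fun t ht => ?_, fun t ht => ?_, hyx⟩
    · have hXt : S.hi X ≤ t := (le_lo_or_hi_le t X).resolve_left fun h =>
        (hx.1.trans_le ht).not_ge (M.strictMono.monotone h)
      exact hy.2.trans (N.strictMono.monotone hXt)
    · have htX : t ≤ S.lo X := (le_lo_or_hi_le t X).resolve_right fun h =>
        (ht.trans_lt hx.2).not_ge (M.strictMono.monotone h)
      exact (N.strictMono.monotone htX).trans hy.1

variable (M N) in
lemma strictMonoOn_and_or_strictAntiOn_and (X : V) :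
    (StrictMonoOn M.map (M.closedCell X) ∧ StrictMonoOn N.map (N.closedCell X)) ∨
      StrictAntiOn M.map (M.closedCell X) ∧ StrictAntiOn N.map (N.closedCell X) :=
  (M.step_lo_ne_step_hi X).lt_or_gt.imp
    (fun h => ⟨M.strictMonoOn_map h, N.strictMonoOn_map h⟩)
    fun h => ⟨M.strictAntiOn_map h, N.strictAntiOn_map h⟩

lemma exists_lift (hψ : IsMatching M.toGrid N.toGrid ψ) :
    ∃ ψ', IsMatching M.toGrid N.toGrid ψ' ∧ ∀ x, N.map (ψ' x) = ψ (M.map x) := by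
  choose ψ' hle hge hlift using exists_lift_apply hψ
  have hcell : ∀ {X x}, x ∈ M.cell X → x ∈ M.closedCell X ∧ ψ' x ∈ N.closedCell X :=
    fun hx => ⟨M.cell_subset_closedCell _ hx, hge _ _ hx.1.le, hle _ _ hx.2.le⟩
  refine ⟨ψ', ⟨fun x y hxy => ?_, fun t => (hle _ t le_rfl).antisymm (hge _ t le_rfl)⟩, hlift⟩
  rcases M.exists_point_mem_Icc_or_mem_cell hxy with ⟨t, hxt, hty⟩ | ⟨X, hx, hy⟩
  · exact (hle x t hxt).trans (hge y t hty)
  obtain ⟨hxM, hxN⟩ := hcell hx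
  obtain ⟨hyM, hyN⟩ := hcell hy
  rcases strictMonoOn_and_or_strictAntiOn_and M N X with ⟨hM, hN⟩ | ⟨hM, hN⟩
  · rw [← hN.le_iff_le hxN hyN, hlift, hlift]
    exact hψ.monotone (hM.monotoneOn hxM hyM hxy)
  · rw [← hN.le_iff_ge hyN hxN, hlift, hlift]
    exact hψ.monotone (hM.antitoneOn hxM hyM hxy)

lemma dist_le_inv_mul_dist_map (hψ : IsMatching M.toGrid N.toGrid ψ)
    (hφ : IsMatching M.toGrid N.toGrid φ) (x : Icc (0 : ℝ) 1) :
    dist (ψ x) (φ x) ≤ (N.slope : ℝ)⁻¹ * dist (N.map (ψ x)) (N.map (φ x)) := by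
  rcases M.exists_eq_point_or_mem_Ioo x with ⟨t, rfl⟩ | ⟨X, hx⟩
  · rw [hψ.apply_point, hφ.apply_point, dist_self]
    positivity
  · have hx' := M.cell_subset_closedCell X hx
    rw [N.dist_map (hψ.mapsTo_closedCell X hx') (hφ.mapsTo_closedCell X hx'),
      inv_mul_cancel_left₀ (NNReal.coe_ne_zero.2 N.slope_pos.ne')]

lemma dist_le_one (x y : Icc (0 : ℝ) 1) : dist x y ≤ 1 := Real.dist_le_of_mem_Icc_01 x.2 y.2

lemma inv_slope_lt_one (M : S.Model) : (M.slope : ℝ)⁻¹ < 1 :=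
  inv_lt_one_of_one_lt₀ (NNReal.one_lt_coe.2 M.one_lt_slope)

variable (M N) in
/-- Lifting contracts the distance between matchings, so its iterates converge to a fixed point. -/
lemma exists_isMatching_semiconj :
    ∃ ψ, IsMatching M.toGrid N.toGrid ψ ∧ Function.Semiconj ψ M.map N.map := by
  obtain ⟨ψ₀, hψ₀⟩ := exists_isMatching M.toGrid N.toGrid
  choose lift hlift hmap using fun ψ : {ψ // IsMatching M.toGrid N.toGrid ψ} => exists_lift ψ.2
  let Ψ : ℕ → {ψ // IsMatching M.toGrid N.toGrid ψ} :=
    Nat.rec ⟨ψ₀, hψ₀⟩ fun _ ψ => ⟨lift ψ, hlift ψ⟩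
  have hΨ : ∀ n x, N.map ((Ψ (n + 1)).1 x) = (Ψ n).1 (M.map x) := fun n => hmap (Ψ n)
  obtain ⟨ψ, hψ⟩ := exists_tendsto_of_dist_le_mul_dist_comp (Ψ := fun n => (Ψ n).1) (f := M.map)
    (by positivity) N.inv_slope_lt_one (fun _ => dist_le_one _ _) fun n x => by
      rw [← hΨ n, ← hΨ (n + 1)]
      exact dist_le_inv_mul_dist_map (Ψ (n + 1)).2 (Ψ (n + 2)).2 x
  refine ⟨ψ, IsMatching.tendsto (fun n => (Ψ n).2) hψ, fun x => ?_⟩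
  have hlim : Tendsto (fun n => N.map ((Ψ (n + 1)).1 x)) atTop (𝓝 (N.map (ψ x))) :=
    (N.continuous_map.tendsto _).comp ((hψ x).comp (tendsto_add_atTop_nat 1))
  simp only [hΨ] at hlim
  exact tendsto_nhds_unique (hψ _) hlim

lemma eq_of_isMatching_semiconj (hψ : IsMatching M.toGrid N.toGrid ψ)
    (hφ : IsMatching M.toGrid N.toGrid φ) (hψ' : Function.Semiconj ψ M.map N.map)
    (hφ' : Function.Semiconj φ M.map N.map) : ψ = φ :=
  eq_of_dist_le_mul_dist_comp (by positivity) N.inv_slope_lt_one (fun _ => dist_le_one _ _)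
    fun x => by
      rw [hψ' x, hφ' x]
      exact dist_le_inv_mul_dist_map hψ hφ x

theorem isConjugateTo (M N : S.Model) : IsConjugateTo M.map N.map := by
  obtain ⟨ψ, hψ, hψc⟩ := exists_isMatching_semiconj M N
  obtain ⟨φ, hφ, hφc⟩ := exists_isMatching_semiconj N M
  have hφψ : φ ∘ ψ = id := eq_of_isMatching_semiconj (hφ.comp hψ) .id
    (hφc.comp_left hψc) Function.Semiconj.id_left
  have hψφ : ψ ∘ φ = id := eq_of_isMatching_semiconj (hψ.comp hφ) .id
    (hψc.comp_left hφc) Function.Semiconj.id_left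
  let e : Icc (0 : ℝ) 1 ≃ Icc (0 : ℝ) 1 := ⟨ψ, φ, congrFun hφψ, congrFun hψφ⟩
  exact ⟨(e.toOrderIso hψ.monotone hφ.monotone).toHomeomorph, hψc⟩

end Model

end MarkovScheme

/-! ### Mixing and entropy of maps with a Markov scheme -/

lemma dense_compl_of_countable {X : Type*} [TopologicalSpace X] [BaireSpace X] [T1Space X]
    [∀ x : X, NeBot (𝓝[≠] x)] {s : Set X} (hs : s.Countable) : Dense sᶜ := by
  rw [← biUnion_of_singleton s, compl_iUnion₂]
  exact dense_biInter_of_isOpen (fun _ _ => isOpen_compl_singleton) hs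
    fun x _ => dense_compl_singleton x

namespace MarkovScheme

namespace Model

variable {V P : Type*} [LinearOrder P] [BoundedOrder P] {S : MarkovScheme V P} (M : S.Model)
  {X Y : V} {x y : Icc (0 : ℝ) 1} {m n : ℕ}

lemma exists_orbit {p : Fin (n + 1) → V} (hp : p ∈ pathSet S.matrix n X Y) (hy : y ∈ M.cell Y) :
    ∃ x, M.map^[n] x = y ∧ ∀ i : Fin (n + 1), M.map^[i] x ∈ M.cell (p i) := by
  induction n generalizing X with
  | zero => exact ⟨y, rfl, fun i => by rwa [Fin.fin_one_eq_zero i, ← Fin.last_zero, hp.2.1]⟩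
  | succ n ih =>
    obtain ⟨hcov, htail⟩ := tail_mem_pathSet hp
    obtain ⟨x', hx', hx'p⟩ := ih htail
    obtain ⟨x, hx, rfl⟩ := (M.cell_subset_image_iff _ _).2 (matrix_eq_one_iff.1 hcov) (hx'p 0)
    exact ⟨x, hx', Fin.cases (by rwa [hp.1]) hx'p⟩

lemma countable_preimage [Countable V] [Countable P] {s : Set (Icc (0 : ℝ) 1)} (hs : s.Countable) :
    (M.map ⁻¹' s).Countable := by
  have hsub : M.map ⁻¹' s ⊆ M.partition ∪ ⋃ X, M.cell X ∩ M.map ⁻¹' s := fun x hx =>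
    (M.mem_partition_or_mem_cell x).imp_right fun ⟨X, hX⟩ => mem_iUnion.2 ⟨X, hX, hx⟩
  refine ((countable_range _).union (countable_iUnion fun X => ?_)).mono hsub
  exact MapsTo.countable_of_injOn (f := M.map) (fun _ hx => hx.2)
    ((M.injOn_map X).mono (inter_subset_left.trans (M.cell_subset_closedCell X))) hs

lemma dense_setOf_forall_iterate_mem_cell [Countable V] [Countable P] :
    Dense {x | ∀ n, ∃ X, M.map^[n] x ∈ M.cell X} := by
  have hcount : ∀ n, (M.map^[n] ⁻¹' M.partition).Countable := by
    intro n
    induction n with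
    | zero => exact countable_range _
    | succ n ih => exact M.countable_preimage ih
  convert dense_compl_of_countable (countable_iUnion hcount) using 1
  ext x
  simp only [mem_ofPred_eq, mem_compl_iff, mem_iUnion, not_exists, mem_preimage,
    M.notMem_partition_iff]

lemma dist_iterate (h : ∀ i < n, ∃ X, M.map^[i] x ∈ M.cell X ∧ M.map^[i] y ∈ M.cell X) :
    dist (M.map^[n] x) (M.map^[n] y) = M.slope ^ n * dist x y := by
  induction n with
  | zero => simp
  | succ n ih =>
    obtain ⟨X, hx, hy⟩ := h n n.lt_succ_self
    rw [Function.iterate_succ_apply', Function.iterate_succ_apply',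
      M.dist_map (M.cell_subset_closedCell X hx) (M.cell_subset_closedCell X hy),
      ih fun i hi => h i (hi.trans n.lt_succ_self)]
    ring

lemma itinerary_mem_pathSet {X : ℕ → V} (hX : ∀ i, M.map^[i] x ∈ M.cell (X i)) (n : ℕ) :
    (fun i : Fin (n + 1) => X i) ∈ pathSet S.matrix n (X 0) (X n) := by
  refine ⟨rfl, rfl, fun i => matrix_eq_one_iff.2 (M.covers_of_mem_cell (hX i) ?_)⟩
  rw [← Function.iterate_succ_apply' M.map]
  exact hX (i + 1)

lemma exists_iterate_eq_dist_le {X : ℕ → V} (hX : ∀ i, M.map^[i] x ∈ M.cell (X i)) (n : ℕ)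
    (hy : y ∈ M.cell (X n)) : ∃ z, M.map^[n] z = y ∧ dist z x ≤ (M.slope : ℝ)⁻¹ ^ n := by
  obtain ⟨z, hz, hzX⟩ := M.exists_orbit (M.itinerary_mem_pathSet hX n) hy
  have hdist := M.dist_iterate (n := n) (x := z) (y := x) fun i hi =>
    ⟨X i, hzX ⟨i, hi.trans n.lt_succ_self⟩, hX i⟩
  refine ⟨z, hz, ?_⟩
  rw [inv_pow, ← mul_one ((_ : ℝ)⁻¹), le_inv_mul_iff₀ (pow_pos (NNReal.coe_pos.2 M.slope_pos) n),
    ← hdist]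
  exact dist_le_one _ _

theorem isTopMixing [Countable V] [Countable P]
    (h : ∀ X Y, ∃ m, ∀ k ≥ m, (pathSet S.matrix k X Y).Nonempty) : IsTopMixing M.map := by
  intro U W hU hW hU' hW'
  obtain ⟨x, hxU, hx⟩ := M.dense_setOf_forall_iterate_mem_cell.inter_open_nonempty U hU hU'
  obtain ⟨z, hzW, hz⟩ := M.dense_setOf_forall_iterate_mem_cell.inter_open_nonempty W hW hW'
  obtain ⟨Y, hzY⟩ := hz 0
  choose X hX using hx
  obtain ⟨r, hr, hball⟩ := Metric.isOpen_iff.1 hU x hxU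
  obtain ⟨n, hn⟩ := exists_pow_lt_of_lt_one hr M.inv_slope_lt_one
  obtain ⟨m, hm⟩ := h (X n) Y
  refine ⟨m + n, fun k hk => ?_⟩
  obtain ⟨j, hj, rfl⟩ : ∃ j ≥ m, k = j + n := ⟨k - n, by omega, by omega⟩
  obtain ⟨q, hq⟩ := hm j hj
  obtain ⟨y', hy'z, hy'⟩ := M.exists_orbit hq hzY
  obtain ⟨y, hyy', hyx⟩ := M.exists_iterate_eq_dist_le hX n (y := y') (hq.1 ▸ hy' 0)
  refine ⟨z, ⟨y, hball (hyx.trans_lt hn), ?_⟩, hzW⟩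
  rw [Function.iterate_add_apply, hyy', hy'z, Function.iterate_zero_apply]

/-- The points whose orbit follows a given path of closed cells. -/
def cylinder (p : Fin (m + 1) → V) : Set (Icc (0 : ℝ) 1) :=
  ⋂ i : Fin (m + 1), M.map^[i] ⁻¹' M.closedCell (p i)

lemma isClosed_cylinder (p : Fin (m + 1) → V) : IsClosed (M.cylinder p) :=
  isClosed_iInter fun i => isClosed_Icc.preimage (M.continuous_map.iterate i)

/-- The orbit of a common point has to meet the partition, hence to stay in it; but no partition
point passes from the closed cell of `d` to that of `e`. -/
lemma disjoint_cylinder {d e : V}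
    (hsep : ∀ t ∈ Icc (S.lo d) (S.hi d), S.step t ∉ Icc (S.lo e) (S.hi e))
    {p q : Fin (m + 1) → V} (hp : p (Fin.last m) = d) (hpq : p ≠ q) :
    Disjoint (M.cylinder p ∩ M.map^[m + 1] ⁻¹' M.closedCell e) (M.cylinder q) := by
  refine Set.disjoint_left.2 fun x ⟨hxp, hxe⟩ hxq => ?_
  rw [cylinder, mem_iInter] at hxp hxq
  obtain ⟨i, hi⟩ := Function.ne_iff.1 hpq
  have hi' : M.map^[i] x ∈ M.partition := by
    by_contra h
    obtain ⟨X, hX⟩ := M.notMem_partition_iff.1 h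
    exact hi ((M.eq_of_mem_cell_of_mem_closedCell hX (hxp i)).symm.trans
      (M.eq_of_mem_cell_of_mem_closedCell hX (hxq i)))
  have hm : M.map^[m] x ∈ M.partition := by
    have h := M.mapsTo_map_partition.iterate (m - i) hi'
    rwa [← Function.iterate_add_apply, Nat.sub_add_cancel (Nat.lt_succ_iff.1 i.2)] at h
  obtain ⟨t, ht⟩ := hm
  have htd : t ∈ Icc (S.lo d) (S.hi d) := by
    rw [← M.point_mem_closedCell_iff, ht, ← hp]
    exact hxp (Fin.last m)
  refine hsep t htd ?_
  rwa [← M.point_mem_closedCell_iff, ← M.map_point, ht, ← Function.iterate_succ_apply' M.map]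

lemma exists_forall_iterate_mem_cylinder {d e : V} (hde : S.Covers d e) (hed : S.Covers e d)
    {k : ℕ} (s : Fin k → pathSet S.matrix m d d) :
    ∃ x ∈ M.cell d, ∀ j : Fin k, M.map^[j * (m + 2)] x ∈
      M.cylinder (s j).1 ∩ M.map^[m + 1] ⁻¹' M.closedCell e := by
  induction k with
  | zero =>
    obtain ⟨x, hx⟩ := M.cell_nonempty d
    exact ⟨x, hx, fun j => j.elim0⟩
  | succ k ih =>
    obtain ⟨z, hz, hzs⟩ := ih fun j => s j.succ
    obtain ⟨c, hc, rfl⟩ := (M.cell_subset_image_iff e d).2 hed hz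
    obtain ⟨b, hb, rfl⟩ := (M.cell_subset_image_iff d e).2 hde hc
    obtain ⟨x, rfl, hx⟩ := M.exists_orbit (s 0).2 hb
    refine ⟨x, (s 0).2.1 ▸ hx 0, Fin.cases ⟨mem_iInter.2 fun i => ?_, ?_⟩ fun j => ?_⟩
    · rw [Fin.val_zero, Nat.zero_mul, Function.iterate_zero_apply]
      exact M.cell_subset_closedCell _ (hx i)
    · rw [Fin.val_zero, Nat.zero_mul, Function.iterate_zero_apply, mem_preimage,
        Function.iterate_succ_apply']
      exact M.cell_subset_closedCell _ hc
    · rw [Fin.val_succ, Nat.succ_mul, Function.iterate_add_apply, Function.iterate_succ_apply',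
        Function.iterate_succ_apply']
      exact hzs j

lemma log_le_coverEntropy_of_pow_le {d e : V} (hde : S.Covers d e) (hed : S.Covers e d)
    (hsep : ∀ t ∈ Icc (S.lo d) (S.hi d), S.step t ∉ Icc (S.lo e) (S.hi e))
    (hfin : (pathSet S.matrix m d d).Finite) {β : ℝ≥0∞}
    (hβ : β ^ (m + 2) ≤ pathCount S.matrix m d d) :
    ENNReal.log β ≤ Dynamics.coverEntropy M.map univ := by
  have := hfin.fintype
  refine log_le_coverEntropy_of_horseshoe (N := m + 2)
    (Z := fun p : pathSet S.matrix m d d => M.cylinder p.1 ∩ M.map^[m + 1] ⁻¹' M.closedCell e)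
    (fun p => ((M.isClosed_cylinder p.1).inter
      (isClosed_Icc.preimage (M.continuous_map.iterate _))).isCompact)
    (fun p q hpq => (M.disjoint_cylinder hsep p.2.2.1 (Subtype.coe_injective.ne hpq)).mono_right
      inter_subset_left)
    (Nat.succ_pos _) (fun k s => ?_) ?_
  · obtain ⟨x, -, hx⟩ := M.exists_forall_iterate_mem_cylinder hde hed s
    exact ⟨x, hx⟩
  · rwa [pathCount, ← Set.coe_fintypeCard, ENat.toENNReal_coe] at hβ

include M in
lemma finite_pathSet_self [Countable P] (n : ℕ) (X : V) : (pathSet S.matrix n X X).Finite := by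
  have hle := pathCount_self_le M.succSum_diam_cell (u := X)
    (ENNReal.ofReal_pos.2 (M.diam_cell_pos X)).ne' ENNReal.ofReal_ne_top n
  have hlt := hle.trans_lt (ENNReal.pow_lt_top ENNReal.coe_lt_top)
  rw [← encard_ne_top_iff]
  exact fun h => by simp [pathCount, h] at hlt

theorem coverEntropy_eq [Countable P] {d e : V} (hde : S.Covers d e) (hed : S.Covers e d)
    (hsep : ∀ t ∈ Icc (S.lo d) (S.hi d), S.step t ∉ Icc (S.lo e) (S.hi e))
    {c : ℝ≥0∞} (hc : c ≠ 0)
    (hcn : ∀ᶠ n in atTop, c * (M.slope : ℝ≥0∞) ^ n ≤ pathCount S.matrix n d d) :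
    Dynamics.coverEntropy M.map univ = (Real.log M.slope : ℝ) := by
  have hlog : ENNReal.log (M.slope : ℝ≥0∞) = (Real.log M.slope : ℝ) := by
    rw [← ENNReal.ofReal_coe_nnreal, ENNReal.log_ofReal_of_pos (NNReal.coe_pos.2 M.slope_pos)]
  rw [← hlog]
  refine (coverEntropy_le_log_of_lipschitzWith M.one_lt_slope.le M.lipschitzWith_map).antisymm ?_
  rw [← EReal.log_exp (Dynamics.coverEntropy M.map univ), ENNReal.log_le_log_iff]
  refine le_of_forall_lt_imp_le_of_dense fun β hβ => ?_
  rw [← ENNReal.log_le_log_iff, EReal.log_exp]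
  have hslope : (M.slope : ℝ≥0∞) ≠ 0 := ENNReal.coe_ne_zero.2 M.slope_pos.ne'
  have hlim : Tendsto (fun n : ℕ => β ^ 2 * (β / M.slope) ^ n) atTop (𝓝 0) := by
    simpa using ENNReal.Tendsto.const_mul
      (ENNReal.tendsto_pow_atTop_nhds_zero_of_lt_one (ENNReal.div_lt_of_lt_mul (by simpa using hβ)))
      (.inr (ENNReal.pow_ne_top hβ.ne_top))
  obtain ⟨n, hn, hcn⟩ := ((hlim.eventually (gt_mem_nhds hc.bot_lt)).and hcn).exists
  refine M.log_le_coverEntropy_of_pow_le hde hed hsep (M.finite_pathSet_self n d)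
    (le_trans ?_ hcn)
  calc β ^ (n + 2) = β ^ 2 * (β / M.slope) ^ n * (M.slope : ℝ≥0∞) ^ n := by
        rw [mul_assoc, ← mul_pow, ENNReal.div_mul_cancel hslope ENNReal.coe_ne_top, pow_add,
          mul_comm]
    _ ≤ c * (M.slope : ℝ≥0∞) ^ n := by gcongr

end Model

end MarkovScheme

/-! ### The Markov scheme of the example -/

section Example

/-- The partition points of the example: `left 0 < left 1 < ⋯` bound the cells `D, C 0, C 1, …`,
`outer i` and `inner i` are the right endpoints of `A i` and `B i`, and `mid` is the common limit of
these sequences. -/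
inductive Pt : Type
  | left (n : ℕ) : Pt
  | mid : Pt
  | inner (i : ℕ) : Pt
  | outer (i : ℕ) : Pt

namespace Pt

/-- The order from left to right of the partition points. -/
def Le : Pt → Pt → Prop
  | left m, left n => m ≤ n
  | left _, _ => True
  | mid, left _ => False
  | mid, _ => True
  | inner i, inner j => j ≤ i
  | inner i, outer j => j ≤ i
  | outer i, inner j => j < i
  | outer i, outer j => j ≤ i
  | inner _, left _ => False
  | inner _, mid => False
  | outer _, left _ => False
  | outer _, mid => False

noncomputable instance : LinearOrder Pt where
  le := Le
  le_refl s := by cases s <;> simp [Le]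
  le_trans r s t := by cases r <;> cases s <;> cases t <;> simp [Le] <;> omega
  le_antisymm s t := by cases s <;> cases t <;> simp [Le] <;> omega
  le_total s t := by cases s <;> cases t <;> simp [Le] <;> omega
  toDecidableLE := Classical.decRel _

lemma le_iff {s t : Pt} : s ≤ t ↔ s.Le t := Iff.rfl

lemma lt_iff {s t : Pt} : s < t ↔ ¬ t.Le s := not_le.symm

instance : BoundedOrder Pt where
  bot := left 0
  bot_le t := by cases t <;> simp [le_iff, Le]
  top := outer 0
  le_top t := by cases t <;> simp [le_iff, Le]

instance : Countable Pt :=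
  Function.Injective.countable (β := ℕ × ℕ)
    (f := fun | left n => (0, n) | mid => (1, 0) | inner i => (2, i) | outer i => (3, i))
    (by intro s t; cases s <;> cases t <;> simp)

/-- The action of the map of the example on the partition points. -/
def step : Pt → Pt
  | left 0 => outer 0
  | left (n + 1) => left n
  | mid => mid
  | inner i => left (i + 1)
  | outer i => outer (i + 1)

end Pt

namespace Cell

/-- The left endpoint of a cell. -/
def lo : Cell → Pt
  | A i => .inner i
  | B i => .outer (i + 1)
  | C i => .left (i + 1)
  | D => .left 0

/-- The right endpoint of a cell. -/
def hi : Cell → Pt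
  | A i => .outer i
  | B i => .inner i
  | C i => .left (i + 2)
  | D => .left 1

lemma lo_covBy_hi (X : Cell) : X.lo ⋖ X.hi := by
  refine covBy_iff_lt_and_eq_or_eq.2 ⟨?_, fun t => ?_⟩
  · cases X <;> simp [lo, hi, Pt.lt_iff, Pt.Le]
  · cases X <;> cases t <;> simp [lo, hi, Pt.le_iff, Pt.Le] <;> omega

lemma lo_injective : lo.Injective := by
  intro X Y
  cases X <;> cases Y <;> simp [lo]

instance : Countable Cell := lo_injective.countable

lemma LeftOf.hi_le_lo {X Y : Cell} (h : X.LeftOf Y) : X.hi ≤ Y.lo := by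
  cases X <;> cases Y <;> simp_all [LeftOf, hi, lo, Pt.le_iff, Pt.Le]

lemma step_lo_lt_step_hi_A (i : ℕ) : (A i).lo.step < (A i).hi.step := by
  simp [lo, hi, Pt.step, Pt.lt_iff, Pt.Le]

lemma step_hi_lt_step_lo_B (i : ℕ) : (B i).hi.step < (B i).lo.step := by
  simp [lo, hi, Pt.step, Pt.lt_iff, Pt.Le]

lemma step_lo_lt_step_hi_C (i : ℕ) : (C i).lo.step < (C i).hi.step := by
  simp [lo, hi, Pt.step, Pt.lt_iff, Pt.Le]

lemma step_hi_lt_step_lo_D : D.hi.step < D.lo.step := by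
  simp [lo, hi, Pt.step, Pt.lt_iff, Pt.Le]

lemma step_notMem_Icc_C_zero (t : Pt) (ht : t ∈ Icc D.lo D.hi) :
    t.step ∉ Icc (C 0).lo (C 0).hi := by
  rcases t with (_ | _ | n) | _ | i | i <;>
    simp_all [lo, hi, Pt.step, Pt.le_iff, Pt.Le]

lemma exists_le_lo_hi_le {s t : Pt} (h : s < t) : ∃ X : Cell, s ≤ X.lo ∧ X.hi ≤ t := by
  rw [Pt.lt_iff] at h
  cases s with
  | left n =>
    refine ⟨n.casesOn D C, ?_⟩
    cases n <;> cases t <;> simp_all [lo, hi, Pt.le_iff, Pt.Le] <;> omega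
  | _ =>
    cases t with
    | inner j => exact ⟨B j, by simp_all [lo, hi, Pt.le_iff, Pt.Le]⟩
    | outer j => exact ⟨A j, by simp_all [lo, hi, Pt.le_iff, Pt.Le]⟩
    | _ => simp_all [Pt.Le]

/-- The combinatorics of the example. -/
noncomputable def scheme : MarkovScheme Cell Pt where
  lo := lo
  hi := hi
  step := Pt.step
  lo_covBy_hi := lo_covBy_hi
  lo_injective := lo_injective

lemma scheme_covers_iff {X Y : Cell} : scheme.Covers X Y ↔ X.Covers Y := by
  rw [MarkovScheme.Covers, uIcc, Icc_subset_Icc_iff (scheme.lo_covBy_hi Y).le, inf_le_iff,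
    le_sup_iff]
  rcases X with i | i | (_ | i) | _ <;> cases Y <;>
    simp [scheme, Covers, lo, hi, Pt.step, Pt.le_iff, Pt.Le] <;> omega

lemma matrix_eq_one_iff {X Y : Cell} : scheme.matrix X Y = 1 ↔ X.Covers Y :=
  MarkovScheme.matrix_eq_one_iff.trans scheme_covers_iff

end Cell

end Example

/-! ### Positions of the partition points -/

section Positions

open NNReal

namespace Pt

section Order

variable {α : Type*} [LinearOrder α] [TopologicalSpace α] [OrderTopology α] {F : Pt → α}

lemma monotone_of_apply_lo_le_apply_hi (h : ∀ X : Cell, F X.lo ≤ F X.hi)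
    (hl : Tendsto (fun n => F (left n)) atTop (𝓝 (F mid)))
    (ho : Tendsto (fun i => F (outer i)) atTop (𝓝 (F mid))) : Monotone F := by
  have hleft : Monotone fun n => F (left n) := monotone_nat_of_le_succ fun n => by
    cases n with
    | zero => exact h .D
    | succ n => exact h (.C n)
  have hinner : ∀ i, F (inner i) ≤ F (outer i) := fun i => h (.A i)
  have houter : ∀ i, F (outer (i + 1)) ≤ F (inner i) := fun i => h (.B i)
  have houter' : Antitone fun i => F (outer i) :=
    antitone_nat_of_succ_le fun i => (houter i).trans (hinner i)
  have hlm : ∀ n, F (left n) ≤ F mid := hleft.ge_of_tendsto hl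
  have hmo : ∀ i, F mid ≤ F (outer i) := houter'.le_of_tendsto ho
  have hmi : ∀ i, F mid ≤ F (inner i) := fun i => (hmo _).trans (houter i)
  have hoi : ∀ {i j}, j < i → F (outer i) ≤ F (inner j) := fun hij =>
    (houter' (Nat.succ_le_of_lt hij)).trans (houter _)
  intro s t hst
  rw [le_iff] at hst
  cases s <;> cases t <;> simp only [Le] at hst
  case left.left => exact hleft hst
  case left.mid => exact hlm _
  case left.inner => exact (hlm _).trans (hmi _)
  case left.outer => exact (hlm _).trans (hmo _)
  case mid.mid => exact le_rfl
  case mid.inner => exact hmi _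
  case mid.outer => exact hmo _
  case inner.inner =>
    rcases hst.eq_or_lt with rfl | hst
    · exact le_rfl
    · exact (hinner _).trans (hoi hst)
  case inner.outer => exact (hinner _).trans (houter' hst)
  case outer.inner => exact hoi hst
  case outer.outer => exact houter' hst

lemma strictMono_of_apply_lo_lt_apply_hi (h : ∀ X : Cell, F X.lo < F X.hi)
    (hl : Tendsto (fun n => F (left n)) atTop (𝓝 (F mid)))
    (ho : Tendsto (fun i => F (outer i)) atTop (𝓝 (F mid))) : StrictMono F := by
  have hF := monotone_of_apply_lo_le_apply_hi (fun X => (h X).le) hl ho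
  intro s t hst
  obtain ⟨X, hs, ht⟩ := Cell.exists_le_lo_hi_le hst
  exact (hF hs).trans_lt ((h X).trans_le (hF ht))

lemma exists_mem_Icc_lo_hi
    (hl : Tendsto (fun n => F (left n)) atTop (𝓝 (F mid)))
    (ho : Tendsto (fun i => F (outer i)) atTop (𝓝 (F mid))) {x : α}
    (hx : x ∈ Icc (F ⊥) (F ⊤)) (hmid : x ≠ F mid) :
    ∃ X : Cell, x ∈ Icc (F X.lo) (F X.hi) := by
  rcases hmid.lt_or_gt with hxm | hxm
  · obtain ⟨N, hN⟩ := (hl.eventually (lt_mem_nhds hxm)).exists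
    induction N with
    | zero => exact absurd hN hx.1.not_gt
    | succ n ih =>
      rcases le_or_gt (F (left n)) x with hn | hn
      · cases n with
        | zero => exact ⟨.D, hn, hN.le⟩
        | succ n => exact ⟨.C n, hn, hN.le⟩
      · exact ih hn
  · obtain ⟨N, hN⟩ := (ho.eventually (gt_mem_nhds hxm)).exists
    induction N with
    | zero => exact absurd hN hx.2.not_gt
    | succ i ih =>
      rcases le_or_gt x (F (outer i)) with hi | hi
      · rcases le_total x (F (inner i)) with hi' | hi'
        · exact ⟨.B i, hN.le, hi'⟩
        · exact ⟨.A i, hi', hi⟩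
      · exact ih hi

lemma exists_eq_or_mem_Ioo_lo_hi
    (hl : Tendsto (fun n => F (left n)) atTop (𝓝 (F mid)))
    (ho : Tendsto (fun i => F (outer i)) atTop (𝓝 (F mid))) {x : α}
    (hx : x ∈ Icc (F ⊥) (F ⊤)) :
    (∃ t, x = F t) ∨ ∃ X : Cell, x ∈ Ioo (F X.lo) (F X.hi) := by
  by_cases h : ∃ t, x = F t
  · exact .inl h
  · push Not at h
    obtain ⟨X, hX⟩ := exists_mem_Icc_lo_hi hl ho hx (h mid)
    exact .inr ⟨X, hX.1.lt_of_ne (h _).symm, hX.2.lt_of_ne (h _)⟩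

end Order

/-- Real positions for the partition points of the example, with total length one. -/
structure IsPosition (F : Pt → ℝ) : Prop where
  apply_lo_lt_apply_hi : ∀ X : Cell, F X.lo < F X.hi
  apply_bot : F ⊥ = 0
  apply_top : F ⊤ = 1
  tendsto_left : Tendsto (fun n => F (left n)) atTop (𝓝 (F mid))
  tendsto_outer : Tendsto (fun i => F (outer i)) atTop (𝓝 (F mid))

namespace IsPosition

variable {F : Pt → ℝ} (hF : IsPosition F)

include hF

lemma strictMono : StrictMono F :=
  strictMono_of_apply_lo_lt_apply_hi hF.apply_lo_lt_apply_hi hF.tendsto_left hF.tendsto_outer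

lemma mem_Icc (t : Pt) : F t ∈ Icc (0 : ℝ) 1 :=
  ⟨hF.apply_bot.symm.trans_le (hF.strictMono.monotone bot_le),
    (hF.strictMono.monotone le_top).trans_eq hF.apply_top⟩

/-- The grid in the unit interval with the given positions. -/
def grid : Cell.scheme.Grid where
  point t := ⟨F t, hF.mem_Icc t⟩
  strictMono _ _ h := hF.strictMono h
  point_bot := Subtype.ext hF.apply_bot
  point_top := Subtype.ext hF.apply_top
  exists_eq_point_or_mem_Ioo x :=
    (exists_eq_or_mem_Ioo_lo_hi hF.tendsto_left hF.tendsto_outer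
      (hF.apply_bot.symm ▸ hF.apply_top.symm ▸ x.2)).imp_left fun ⟨t, ht⟩ => ⟨t, Subtype.ext ht⟩

lemma diam_grid_cell (X : Cell) : Metric.diam (hF.grid.cell X) = F X.hi - F X.lo :=
  hF.grid.diam_cell X

/-- It suffices to compare neighbours: then `l • F + F ∘ step` and `l • F - F ∘ step` are
monotone. -/
lemma abs_sub_step_le {l : ℝ}
    (h : ∀ X : Cell, |F X.hi.step - F X.lo.step| ≤ l * (F X.hi - F X.lo)) (s t : Pt) :
    |F s.step - F t.step| ≤ l * |F s - F t| := by
  wlog hst : t ≤ s generalizing s t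
  · rw [abs_sub_comm, abs_sub_comm (F s)]
    exact this t s (le_of_not_ge hst)
  have hl : Tendsto (fun n => F (step (left n))) atTop (𝓝 (F mid)) :=
    (tendsto_add_atTop_iff_nat 1).1 hF.tendsto_left
  have ho : Tendsto (fun i => F (step (outer i))) atTop (𝓝 (F mid)) :=
    (tendsto_add_atTop_iff_nat 1).2 hF.tendsto_outer
  have hadd : Monotone fun t => l * F t + F t.step :=
    monotone_of_apply_lo_le_apply_hi (fun X => by linarith [(abs_le.1 (h X)).1])
      ((hF.tendsto_left.const_mul l).add hl) ((hF.tendsto_outer.const_mul l).add ho)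
  have hsub : Monotone fun t => l * F t - F t.step :=
    monotone_of_apply_lo_le_apply_hi (fun X => by linarith [(abs_le.1 (h X)).2])
      ((hF.tendsto_left.const_mul l).sub hl) ((hF.tendsto_outer.const_mul l).sub ho)
  rw [abs_of_nonneg (sub_nonneg.2 (hF.strictMono.monotone hst)), abs_le]
  constructor <;> linarith [hadd hst, hsub hst]

/-- The model in which the dynamics stretches every cell by the same factor. -/
def model {l : ℝ≥0} (hl : 1 < l)
    (h : ∀ X : Cell, |F X.hi.step - F X.lo.step| = l * (F X.hi - F X.lo)) :
    Cell.scheme.Model where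
  toGrid := hF.grid
  slope := l
  one_lt_slope := hl
  dist_point_step X := by
    have hlen := abs_of_pos (sub_pos.2 (hF.apply_lo_lt_apply_hi X))
    have hX := (h X).trans (congrArg _ hlen.symm)
    rwa [abs_sub_comm, abs_sub_comm (F X.hi)] at hX
  dist_point_step_le := hF.abs_sub_step_le fun X => (h X).le

end IsPosition

end Pt

end Positions

/-! ### The possible slopes -/

section Slopes

open NNReal

/-- The polynomial whose real root is the smallest slope. -/
def cubic (x : ℝ) : ℝ := x ^ 3 - 2 * x ^ 2 - x - 2

lemma two_lt_of_cubic_nonneg {x : ℝ} (hx : 0 ≤ cubic x) : 2 < x := by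
  by_contra! h
  rw [cubic] at hx
  nlinarith [mul_nonneg (sq_nonneg x) (sub_nonneg.2 h), sq_nonneg (x + 2)]

lemma cubic_le_cubic_iff {x y : ℝ} (hx : 2 < x) (hy : 2 < y) : cubic x ≤ cubic y ↔ x ≤ y := by
  have hpos : 0 < x ^ 2 + x * y + y ^ 2 - 2 * (x + y) - 1 := by nlinarith
  have hsub : cubic y - cubic x = (y - x) * (x ^ 2 + x * y + y ^ 2 - 2 * (x + y) - 1) := by
    unfold cubic
    ring
  rw [← sub_nonneg, hsub, mul_nonneg_iff_of_pos_right hpos, sub_nonneg]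

lemma exists_cubic_eq_zero : ∃ x, cubic x = 0 := by
  have hcont : Continuous cubic := by
    unfold cubic
    fun_prop
  obtain ⟨x, -, hx⟩ := intermediate_value_Icc (a := 2) (b := 3) (by norm_num) hcont.continuousOn
    (show (0 : ℝ) ∈ _ by constructor <;> norm_num [cubic])
  exact ⟨x, hx⟩

lemma cubic_nonneg_iff {l x : ℝ} (hl : cubic l = 0) : 0 ≤ cubic x ↔ l ≤ x := by
  have hl2 := two_lt_of_cubic_nonneg hl.ge
  rw [← hl]
  exact ⟨fun h => (cubic_le_cubic_iff hl2 (two_lt_of_cubic_nonneg (hl ▸ h))).1 h,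
    fun h => (cubic_le_cubic_iff hl2 (hl2.trans_le h)).2 h⟩

lemma cubic_eq_zero_iff {l x : ℝ} (hl : cubic l = 0) : cubic x = 0 ↔ x = l :=
  ⟨fun hx => ((cubic_nonneg_iff hx).1 hl.ge).antisymm ((cubic_nonneg_iff hl).1 hx.ge),
    fun h => h ▸ hl⟩

lemma denominator_pos {l : ℝ} (hl : 2 < l) : 0 < l ^ 3 - l ^ 2 - l - 1 := by
  nlinarith [sq_nonneg (l - 2)]

namespace OfSlope

variable (l : ℝ)

/-- The root of `x ^ 2 + (1 + l) * x = l` in the unit interval. -/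
noncomputable def root : ℝ := (√((1 + l) ^ 2 + 4 * l) - (1 + l)) / 2

/-- The coefficient of `l⁻¹ ^ i` in `offset l i`. -/
noncomputable def slopeCoeff : ℝ := 2 * l / ((l - 1) * (l ^ 3 - l ^ 2 - l - 1))

/-- The coefficient of `root l ^ i` in `offset l i`. -/
noncomputable def rootCoeff : ℝ := cubic l / (l ^ 3 - l ^ 2 - l - 1)

/-- The distance from `mid` to `outer i`. It solves the linear recursion `offset_rec` which
expresses that the cells `B i` are stretched by the factor `l`; the initial value places
`outer 0` at `1`. -/
noncomputable def offset (i : ℕ) : ℝ := slopeCoeff l * l⁻¹ ^ i + rootCoeff l * root l ^ i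

/-- The positions of the partition points for which every cell is stretched by the factor `l`. -/
noncomputable def position : Pt → ℝ
  | .left n => (l - 1)⁻¹ * (1 - l⁻¹ ^ n)
  | .mid => (l - 1)⁻¹
  | .inner i => (l - 1)⁻¹ + offset l i - (offset l (i + 1) + (l - 1)⁻¹ * l⁻¹ ^ (i + 1)) / l
  | .outer i => (l - 1)⁻¹ + offset l i

variable {l}

lemma position_bot : position l ⊥ = 0 := by
  change (l - 1)⁻¹ * (1 - l⁻¹ ^ 0) = 0
  simp

section Offset

variable (hl : 2 < l)

include hl

lemma root_sq : root l ^ 2 + (1 + l) * root l = l := by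
  have := Real.sq_sqrt (show 0 ≤ (1 + l) ^ 2 + 4 * l by positivity)
  unfold root
  linarith

lemma root_pos : 0 < root l := by
  have : 1 + l < √((1 + l) ^ 2 + 4 * l) := Real.lt_sqrt_of_sq_lt (by linarith)
  unfold root
  linarith

lemma root_lt_one : root l < 1 := by
  by_contra! h
  nlinarith [root_sq hl]

lemma slopeCoeff_add_rootCoeff : slopeCoeff l + rootCoeff l = (l - 2) / (l - 1) := by
  have h₁ : l - 1 ≠ 0 := by linarith
  have h₂ := (denominator_pos hl).ne'
  rw [slopeCoeff, rootCoeff, cubic]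
  generalize hq : l ^ 3 - l ^ 2 - l - 1 = q at h₂ ⊢
  field_simp
  rw [← hq]
  ring

lemma slopeCoeff_mul : slopeCoeff l * (l - (1 + l) * l⁻¹ - l⁻¹ ^ 2) = 2 * (l - 1)⁻¹ * l⁻¹ := by
  have h₁ : l - 1 ≠ 0 := by linarith
  have h₂ := (denominator_pos hl).ne'
  have h₃ : l ≠ 0 := by linarith
  rw [slopeCoeff, div_mul_eq_mul_div, div_eq_iff (mul_ne_zero h₁ h₂)]
  field_simp
  ring

lemma offset_rec (i : ℕ) : l * offset l i =
    (1 + l) * offset l (i + 1) + offset l (i + 2) + 2 * ((l - 1)⁻¹ * l⁻¹ ^ (i + 1)) := by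
  unfold offset
  linear_combination l⁻¹ ^ i * slopeCoeff_mul hl - rootCoeff l * root l ^ i * root_sq hl

lemma tendsto_inv_pow : Tendsto (fun n : ℕ => l⁻¹ ^ n) atTop (𝓝 0) :=
  tendsto_pow_atTop_nhds_zero_of_lt_one (by rw [inv_nonneg]; linarith)
    (inv_lt_one_of_one_lt₀ (by linarith))

lemma tendsto_offset : Tendsto (offset l) atTop (𝓝 0) := by
  have hroot := tendsto_pow_atTop_nhds_zero_of_lt_one (root_pos hl).le (root_lt_one hl)
  have := ((tendsto_inv_pow hl).const_mul (slopeCoeff l)).add (hroot.const_mul (rootCoeff l))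
  rwa [mul_zero, mul_zero, add_zero] at this

lemma slope_mul_A (i : ℕ) : l * (position l (.outer i) - position l (.inner i)) =
    offset l (i + 1) + (l - 1)⁻¹ * l⁻¹ ^ (i + 1) := by
  have : l ≠ 0 := by linarith
  simp only [position, sub_sub_cancel]
  exact mul_div_cancel₀ _ this

lemma slope_mul_B (i : ℕ) : l * (position l (.inner i) - position l (.outer (i + 1))) =
    offset l (i + 2) + (l - 1)⁻¹ * l⁻¹ ^ (i + 1) := by
  have hA := slope_mul_A hl i
  simp only [position] at hA ⊢
  linarith [offset_rec hl i]

lemma position_left_succ_sub (n : ℕ) :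
    position l (.left (n + 1)) - position l (.left n) = l⁻¹ ^ (n + 1) := by
  have h₁ : l - 1 ≠ 0 := by linarith
  have h₂ : l ≠ 0 := by linarith
  simp only [position, pow_succ, inv_pow]
  field_simp
  ring

lemma position_top : position l ⊤ = 1 := by
  have : l - 1 ≠ 0 := by linarith
  change (l - 1)⁻¹ + (slopeCoeff l * l⁻¹ ^ 0 + rootCoeff l * root l ^ 0) = 1
  rw [pow_zero, pow_zero, mul_one, mul_one, slopeCoeff_add_rootCoeff hl]
  field_simp
  ring

end Offset

section Position

variable (h : 0 ≤ cubic l)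

include h

lemma offset_pos (i : ℕ) : 0 < offset l i := by
  have hl := two_lt_of_cubic_nonneg h
  have hs : 0 < slopeCoeff l :=
    div_pos (by linarith) (mul_pos (by linarith) (denominator_pos hl))
  have hr : 0 ≤ rootCoeff l := div_nonneg h (denominator_pos hl).le
  have := root_pos hl
  unfold offset
  positivity

lemma position_lo_lt_hi (X : Cell) : position l X.lo < position l X.hi := by
  have hl := two_lt_of_cubic_nonneg h
  have hl0 : 0 < l := by linarith
  have hmid : 0 < (l - 1)⁻¹ := inv_pos.2 (by linarith)
  have hoff := offset_pos h
  rw [← sub_pos]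
  refine pos_of_mul_pos_right (a := l) ?_ hl0.le
  cases X with
  | A i =>
    rw [Cell.hi, Cell.lo, slope_mul_A hl]
    have := hoff (i + 1)
    positivity
  | B i =>
    rw [Cell.hi, Cell.lo, slope_mul_B hl]
    have := hoff (i + 2)
    positivity
  | C i =>
    rw [Cell.hi, Cell.lo, position_left_succ_sub hl]
    positivity
  | D =>
    rw [Cell.hi, Cell.lo, position_left_succ_sub hl]
    positivity

lemma isPosition : Pt.IsPosition (position l) where
  apply_lo_lt_apply_hi := position_lo_lt_hi h
  apply_bot := position_bot
  apply_top := position_top (two_lt_of_cubic_nonneg h)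
  tendsto_left := by
    simpa [position] using
      ((tendsto_inv_pow (two_lt_of_cubic_nonneg h)).const_sub 1).const_mul (l - 1)⁻¹
  tendsto_outer := by
    simpa [position] using (tendsto_offset (two_lt_of_cubic_nonneg h)).const_add (l - 1)⁻¹

lemma abs_position_step_sub (X : Cell) : |position l X.hi.step - position l X.lo.step| =
    l * (position l X.hi - position l X.lo) := by
  have hl := two_lt_of_cubic_nonneg h
  have hpos : 0 ≤ l * (position l X.hi - position l X.lo) :=
    mul_nonneg (by linarith) (sub_nonneg.2 (position_lo_lt_hi h X).le)
  rw [← abs_of_nonneg hpos, abs_eq_abs]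
  have hinv : l * l⁻¹ = 1 := mul_inv_cancel₀ (by linarith)
  cases X with
  | A i =>
    left
    rw [Cell.hi, Cell.lo, slope_mul_A hl]
    simp only [Pt.step, position]
    ring
  | B i =>
    right
    rw [Cell.hi, Cell.lo, slope_mul_B hl]
    simp only [Pt.step, position]
    ring
  | C i =>
    left
    rw [Cell.hi, Cell.lo, position_left_succ_sub hl, pow_succ', ← mul_assoc, hinv, one_mul]
    exact position_left_succ_sub hl i
  | D =>
    right
    rw [Cell.hi, Cell.lo, position_left_succ_sub hl, pow_one, hinv]
    change position l ⊥ - position l ⊤ = -1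
    rw [position_bot, position_top hl, zero_sub]

/-- The model of slope `l`. -/
noncomputable def model : Cell.scheme.Model :=
  (isPosition h).model (l := ⟨l, by linarith [two_lt_of_cubic_nonneg h]⟩)
    (one_lt_two.trans (two_lt_of_cubic_nonneg h)) (abs_position_step_sub h)

end Position

lemma position_hi_sub_lo (h : cubic l = 0) (X : Cell) : position l X.hi - position l X.lo =
    X.weight l / (l ^ 2 * (l ^ 3 - l ^ 2 - l - 1)) := by
  have hl := two_lt_of_cubic_nonneg h.ge
  have h₁ : l - 1 ≠ 0 := by linarith
  have h₂ := (denominator_pos hl).ne'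
  have h₃ : l ≠ 0 := by linarith
  have hoff : ∀ i, offset l i = slopeCoeff l * l⁻¹ ^ i := fun i => by
    rw [offset, rootCoeff, h, zero_div, zero_mul, add_zero]
  refine mul_left_cancel₀ h₃ ?_
  cases X with
  | A i =>
    rw [Cell.hi, Cell.lo, slope_mul_A hl, hoff, slopeCoeff, Cell.weight]
    simp only [inv_pow]
    generalize hq : l ^ 3 - l ^ 2 - l - 1 = q at h₂ ⊢
    field_simp
    rw [← hq]
    ring
  | B i =>
    rw [Cell.hi, Cell.lo, slope_mul_B hl, hoff, slopeCoeff, Cell.weight]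
    simp only [inv_pow]
    generalize hq : l ^ 3 - l ^ 2 - l - 1 = q at h₂ ⊢
    field_simp
    rw [← hq]
    ring
  | C i =>
    rw [Cell.hi, Cell.lo, position_left_succ_sub hl, Cell.weight]
    simp only [inv_pow]
    generalize l ^ 3 - l ^ 2 - l - 1 = q at h₂ ⊢
    field_simp
    ring
  | D =>
    rw [Cell.hi, Cell.lo, position_left_succ_sub hl, Cell.weight]
    simp only [inv_pow]
    generalize l ^ 3 - l ^ 2 - l - 1 = q at h₂ ⊢
    field_simp
    ring

lemma isExampleMap (h : cubic l = 0) :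
    IsExampleMap l (model h.ge).map (model h.ge).partition (model h.ge).cell where
  isCPMM := (model h.ge).isCPMM
  basic := (model h.ge).isBasicInterval_partition_iff
  order _ _ hXY _ hx _ hy := (model h.ge).lt_of_hi_le_lo hXY.hi_le_lo hx hy
  length X := ((isPosition h.ge).diam_grid_cell X).trans (position_hi_sub_lo h X)
  covers X Y := ((model h.ge).cell_subset_image_iff X Y).trans Cell.scheme_covers_iff
  strictMono_A i := ((model h.ge).strictMonoOn_map (X := .A i)
    (Cell.step_lo_lt_step_hi_A i)).mono ((model h.ge).cell_subset_closedCell _)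
  strictMono_C i := ((model h.ge).strictMonoOn_map (X := .C i)
    (Cell.step_lo_lt_step_hi_C i)).mono ((model h.ge).cell_subset_closedCell _)
  strictAnti_B i := ((model h.ge).strictAntiOn_map (X := .B i)
    (Cell.step_hi_lt_step_lo_B i)).mono ((model h.ge).cell_subset_closedCell _)
  strictAnti_D := ((model h.ge).strictAntiOn_map (X := .D)
    Cell.step_hi_lt_step_lo_D).mono ((model h.ge).cell_subset_closedCell _)
  slope := (model h.ge).hasConstantSlope

end OfSlope

end Slopes

/-! ### The Markov chain of the example -/

section Chain

open NNReal

namespace Doubling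

/-- The positions of the partition points for which every cell other than `D` is stretched by the
factor `2`. As `2` is smaller than the slope, they show that paths avoiding `D` are rare. -/
noncomputable def position : Pt → ℝ
  | .left n => 1 / 5 * (1 - (1 / 2) ^ n)
  | .mid => 1 / 5
  | .inner i => 1 / 5 + 11 / 20 * (1 / 2) ^ i
  | .outer i => 1 / 5 + 4 / 5 * (1 / 2) ^ i

/-- The lengths of the cells in the doubling positions, up to the factor `20`. -/
noncomputable def weight : Cell → ℝ
  | .A i => 5 * (1 / 2) ^ i
  | .B i => 3 * (1 / 2) ^ i
  | .C i => (1 / 2) ^ i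
  | .D => 2

lemma weight_pos (X : Cell) : 0 < weight X := by
  cases X <;> simp only [weight] <;> positivity

lemma position_hi_sub_lo (X : Cell) : position X.hi - position X.lo = weight X / 20 := by
  cases X <;> simp only [Cell.hi, Cell.lo, position, weight, pow_succ] <;> ring

lemma isPosition : Pt.IsPosition position where
  apply_lo_lt_apply_hi X := by
    rw [← sub_pos, position_hi_sub_lo]
    exact div_pos (weight_pos X) (by norm_num)
  apply_bot := by
    change 1 / 5 * (1 - (1 / 2) ^ 0) = (0 : ℝ)
    norm_num
  apply_top := by
    change 1 / 5 + 4 / 5 * (1 / 2) ^ 0 = (1 : ℝ)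
    norm_num
  tendsto_left := by
    have := tendsto_pow_atTop_nhds_zero_of_lt_one (r := (1 / 2 : ℝ)) (by norm_num) (by norm_num)
    simpa only [position, sub_zero, mul_one] using (this.const_sub 1).const_mul (1 / 5)
  tendsto_outer := by
    have := tendsto_pow_atTop_nhds_zero_of_lt_one (r := (1 / 2 : ℝ)) (by norm_num) (by norm_num)
    simpa only [position, mul_zero, add_zero] using (this.const_mul (4 / 5)).const_add (1 / 5)

lemma abs_position_step_sub {X : Cell} (hX : X ≠ .D) :
    |position X.hi.step - position X.lo.step| = 2 * (weight X / 20) := by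
  have hpos : 0 ≤ 2 * (weight X / 20) := by linarith [weight_pos X]
  rw [← abs_of_nonneg hpos, abs_eq_abs]
  cases X with
  | A i => left; simp only [Cell.hi, Cell.lo, Pt.step, position, weight, pow_succ]; ring
  | B i => right; simp only [Cell.hi, Cell.lo, Pt.step, position, weight, pow_succ]; ring
  | C i => left; simp only [Cell.hi, Cell.lo, Pt.step, position, weight, pow_succ]; ring
  | D => exact absurd rfl hX

lemma succSum_weight (X : Cell) :
    succSum Cell.scheme.matrix (fun Y => ENNReal.ofReal (weight Y)) X =
      ENNReal.ofReal (20 * |position X.hi.step - position X.lo.step|) := by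
  have hweight : (fun Y => ENNReal.ofReal (weight Y)) =
      (20 : ℝ≥0∞) • fun Y => ENNReal.ofReal (Metric.diam (isPosition.grid.cell Y)) := by
    ext Y
    rw [Pi.smul_apply, isPosition.diam_grid_cell, position_hi_sub_lo, smul_eq_mul,
      ← ENNReal.ofReal_ofNat, ← ENNReal.ofReal_mul (by norm_num), mul_div_cancel₀ _ (by norm_num)]
  rw [hweight, map_smul, Pi.smul_apply, isPosition.grid.succSum_diam_cell, edist_dist, smul_eq_mul,
    ENNReal.ofReal_mul (by norm_num), ENNReal.ofReal_ofNat]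
  rfl

lemma isTabooVector : IsTabooVector Cell.scheme.matrix .D 2 20
    (({.D}ᶜ : Set Cell).indicator fun X => ENNReal.ofReal (weight X)) where
  apply_self := by simp
  one_le X hX h := by
    rw [Cell.matrix_eq_one_iff] at h
    rcases X with i | i | (_ | i) | _ <;> simp_all [Cell.Covers, weight]
  succSum_le X := by
    refine (monotone_succSum (indicator_le_self _ _) X).trans ?_
    rw [succSum_weight]
    rcases eq_or_ne X .D with rfl | hX
    · have hone : |position Cell.D.hi.step - position Cell.D.lo.step| ≤ 1 :=
        abs_sub_le_of_nonneg_of_le (isPosition.mem_Icc _).1 (isPosition.mem_Icc _).2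
          (isPosition.mem_Icc _).1 (isPosition.mem_Icc _).2
      simpa using mul_le_mul_right (ENNReal.ofReal_le_one.2 hone) 20
    · rw [abs_position_step_sub hX, mul_left_comm, mul_div_cancel₀ _ (by norm_num)]
      simp [hX, ENNReal.ofReal_mul]

end Doubling

lemma OfSlope.position_hi_sub_lo_le_weight {l : ℝ} (h : cubic l = 0) {X : Cell} (hX : X ≠ .D) :
    position l X.hi - position l X.lo ≤ Doubling.weight X := by
  have hl := two_lt_of_cubic_nonneg h.ge
  have hq : l ^ 3 - l ^ 2 - l - 1 = l ^ 2 + 1 := by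
    rw [cubic] at h
    linarith
  have hpow : ∀ i : ℕ, (l ^ 2 + 1) / l ^ i ≤ (l ^ 2 + 1) * (1 / 2) ^ i := fun i => by
    rw [div_eq_mul_one_div, ← one_div_pow]
    gcongr
  have hweight : X.weight l ≤ (l ^ 2 + 1) * Doubling.weight X := by
    cases X with
    | A i =>
      simp only [Cell.weight, Doubling.weight]
      linarith [hpow i, show 0 < (l ^ 2 + 1) * (1 / 2 : ℝ) ^ i by positivity]
    | B i =>
      have hle : (l ^ 2 - 1) / l ^ i ≤ (l ^ 2 + 1) / l ^ i := by
        gcongr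
        linarith
      simp only [Cell.weight, Doubling.weight]
      linarith [hpow i, show 0 < (l ^ 2 + 1) * (1 / 2 : ℝ) ^ i by positivity]
    | C i =>
      rw [Cell.weight, Doubling.weight, hq]
      exact hpow i
    | D => exact absurd rfl hX
  rw [position_hi_sub_lo h, hq, div_le_iff₀ (by positivity)]
  have hnonneg : 0 ≤ (l ^ 2 + 1) * Doubling.weight X :=
    mul_nonneg (by positivity) (Doubling.weight_pos X).le
  have hone : 1 ≤ l ^ 2 := one_le_pow₀ (by linarith)
  linarith [le_mul_of_one_le_left hnonneg hone]

namespace Cell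

lemma scheme_matrix_D (X : Cell) : scheme.matrix .D X = 1 := matrix_eq_one_iff.2 trivial

lemma exists_nonempty_pathSet_D (X : Cell) : ∃ n, (pathSet scheme.matrix n X .D).Nonempty := by
  have hcons : ∀ {X Y n}, X.Covers Y → (pathSet scheme.matrix n Y .D).Nonempty →
      ∃ n, (pathSet scheme.matrix n X .D).Nonempty := fun hXY hY =>
    ⟨_, nonempty_pathSet_add (nonempty_pathSet_one (matrix_eq_one_iff.2 hXY)) hY⟩
  have hC : ∀ i, ∃ n, (pathSet scheme.matrix n (C i) .D).Nonempty := fun i => by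
    induction i with
    | zero => exact hcons rfl (nonempty_pathSet_zero D)
    | succ i ih =>
      obtain ⟨n, hn⟩ := ih
      exact hcons rfl hn
  cases X with
  | A i =>
    obtain ⟨n, hn⟩ := hC i
    exact hcons (X := A i) (Y := C i) (le_refl i) hn
  | B i =>
    obtain ⟨n, hn⟩ := hC i
    exact hcons (X := B i) (Y := C i) (le_refl i) hn
  | C i => exact hC i
  | D => exact ⟨0, nonempty_pathSet_zero D⟩

lemma exists_forall_ge_nonempty_pathSet (X Y : Cell) :
    ∃ m, ∀ k ≥ m, (pathSet scheme.matrix k X Y).Nonempty := by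
  obtain ⟨m, hm⟩ := exists_nonempty_pathSet_D X
  have hDD : ∀ k, (pathSet scheme.matrix k .D .D).Nonempty := fun k => by
    induction k with
    | zero => exact nonempty_pathSet_zero D
    | succ k ih => exact nonempty_pathSet_add ih (nonempty_pathSet_one (scheme_matrix_D D))
  refine ⟨m + 1, fun k hk => ?_⟩
  obtain ⟨j, hj⟩ := Nat.exists_eq_add_of_le hk
  obtain rfl : k = m + j + 1 := by omega
  exact nonempty_pathSet_add (nonempty_pathSet_add hm (hDD j))
    (nonempty_pathSet_one (scheme_matrix_D Y))

lemma isTransitiveChain : IsTransitiveChain scheme.matrix := fun X Y => by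
  obtain ⟨m, hm⟩ := exists_forall_ge_nonempty_pathSet X Y
  exact ⟨m + 1, by simp, hm _ m.le_succ⟩

lemma scheme_matrix_eq_zero_or_one (X Y : Cell) :
    scheme.matrix X Y = 0 ∨ scheme.matrix X Y = 1 := by
  unfold MarkovScheme.matrix
  split_ifs <;> simp

end Cell

end Chain

section Conclusion

open NNReal

namespace OfSlope

variable {l : ℝ} (h : cubic l = 0)

include h

lemma exists_mul_pow_le_pathCount : ∃ c : ℝ≥0∞, c ≠ 0 ∧ c ≠ ⊤ ∧
    ∀ᶠ n in atTop, c * ((model h.ge).slope : ℝ≥0∞) ^ n ≤ pathCount Cell.scheme.matrix n .D .D := by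
  have hD := ENNReal.ofReal_pos.2 ((model h.ge).diam_cell_pos .D)
  refine Doubling.isTabooVector.exists_mul_pow_le_pathCount (C := 1) (Cell.scheme_matrix_D .D)
    (model h.ge).succSum_diam_cell hD.ne' ENNReal.ofReal_ne_top (fun X hX => ?_)
    (two_lt_of_cubic_nonneg h.ge)
  have hle : Metric.diam ((model h.ge).cell X) ≤ Doubling.weight X :=
    ((isPosition h.ge).diam_grid_cell X).trans_le (position_hi_sub_lo_le_weight h hX)
  simpa [hX] using ENNReal.ofReal_le_ofReal hle

lemma hasPerronValue : HasPerronValue Cell.scheme.matrix ((model h.ge).slope : ℝ≥0∞) :=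
  hasPerronValue_of_exists_mul_pow_le Cell.isTransitiveChain (model h.ge).succSum_diam_cell
    (fun X => (ENNReal.ofReal_pos.2 ((model h.ge).diam_cell_pos X)).ne')
    (fun _ => ENNReal.ofReal_ne_top) (one_pos.trans (model h.ge).one_lt_slope).ne'
    (exists_mul_pow_le_pathCount h)

lemma isStronglyPositiveRecurrent : IsStronglyPositiveRecurrent Cell.scheme.matrix :=
  ⟨Cell.isTransitiveChain, (model h.ge).slope, hasPerronValue h, .D,
    (Doubling.isTabooVector.firstReturnRate_le one_le_two).trans_lt
      (ENNReal.coe_lt_coe.2 (two_lt_of_cubic_nonneg h.ge))⟩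

lemma exists_isNonnegEigenvector_iff {x : ℝ} :
    (∃ v, IsNonnegEigenvector Cell.scheme.matrix x v) ↔ l ≤ x := by
  refine ⟨fun ⟨v, hv⟩ => ?_, fun hx => ?_⟩
  · exact hv.le_of_mul_pow_le_pathCount Cell.scheme_matrix_D Cell.scheme_matrix_eq_zero_or_one
      (exists_mul_pow_le_pathCount h)
  · have hx := (cubic_nonneg_iff h).2 hx
    refine ⟨_, (isNonnegEigenvector_coe_iff Cell.scheme_matrix_eq_zero_or_one
      (l := (model hx).slope)).2 ⟨fun hzero => ?_, (model hx).succSum_diam_cell⟩⟩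
    exact (Real.toNNReal_pos.2 ((model hx).diam_cell_pos .D)).ne' (congrFun hzero .D)

lemma coverEntropy_map :
    Dynamics.coverEntropy (model h.ge).map univ = (Real.log l : ℝ) := by
  obtain ⟨c, hc, -, hcn⟩ := exists_mul_pow_le_pathCount h
  exact (model h.ge).coverEntropy_eq (d := .D) (e := .C 0) (Cell.scheme_covers_iff.2 trivial)
    (Cell.scheme_covers_iff.2 rfl) Cell.step_notMem_Icc_C_zero hc hcn

end OfSlope

namespace MarkovScheme.Model

variable (M : Cell.scheme.Model)

lemma not_isConjugateTo_of_eq_bot_or_eq_top {a b : EReal} {g : Icc a b → Icc a b}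
    {Q : Set (Icc a b)} {l : ℝ} (hab : a = ⊥ ∨ b = ⊤) (hg : IsCPMM g Q)
    (hl : HasConstantSlopeExt g Q l) : ¬ IsConjugateTo M.map g := by
  have hcell : ∀ X, ∀ z ∈ M.cell X, ¬ IsMin (M.map z) ∧ ¬ IsMax (M.map z) := by
    intro X z hz
    have hmem := M.image_cell X ▸ mem_image_of_mem M.map hz
    exact ⟨not_isMin_of_lt hmem.1, not_isMax_of_lt hmem.2⟩
  have hD : M.map '' M.cell .D = {x | ¬ IsMin x ∧ ¬ IsMax x} := by
    refine Subset.antisymm (image_subset_iff.2 fun z => hcell .D z) fun x hx => ?_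
    rw [M.image_cell]
    change x ∈ uIoo (M.point ⊤) (M.point ⊥)
    rw [M.point_top, M.point_bot, uIoo_of_ge zero_le_one]
    exact ⟨not_le.1 fun h => hx.1 fun y _ => h.trans y.2.1,
      not_le.1 fun h => hx.2 fun y _ => y.2.2.trans h⟩
  have hlo : ¬ IsMin (M.point (Cell.C 0).lo) :=
    not_isMin_of_lt (M.strictMono (Cell.lo_covBy_hi .D).lt)
  have hhi : ¬ IsMax (M.point (Cell.C 0).hi) :=
    not_isMax_of_lt (M.strictMono (Cell.lo_covBy_hi (.C 1)).lt)
  exact not_isConjugateTo_of_infinite_length hlo hhi (M.cell_subset_closedCell (.C 0))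
    isPreconnected_Ioo isPreconnected_Ioo (hcell (.C 0))
    ((M.cell_subset_image_iff _ _).2 (Cell.scheme_covers_iff.2 rfl)) hD hab hg hl

end MarkovScheme.Model

end Conclusion

theorem mainTheorem4 :
    ∃ lmin : ℝ, (∀ x : ℝ, x ^ 3 - 2 * x ^ 2 - x - 2 = 0 ↔ x = lmin) ∧
    ∃ (f : Icc (0 : ℝ) 1 → Icc (0 : ℝ) 1) (P : Set (Icc (0 : ℝ) 1))
      (K : Cell → Set (Icc (0 : ℝ) 1)),
      IsExampleMap lmin f P K ∧
      IsCPMM f P ∧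
      IsTopMixing f ∧
      (∀ (l : ℝ) (v : BasicInterval P → ℝ),
        IsNonnegEigenvector (transitionMatrix f P) l v → Summable v) ∧
      (∀ l : ℝ, (∃ v : BasicInterval P → ℝ,
        IsNonnegEigenvector (transitionMatrix f P) l v) ↔ lmin ≤ l) ∧
      (∀ l : ℝ, lmin ≤ l →
        ∃ (g : Icc (0 : ℝ) 1 → Icc (0 : ℝ) 1) (Q : Set (Icc (0 : ℝ) 1)),
          IsCPMM g Q ∧ HasConstantSlope g Q l ∧ IsConjugateTo f g) ∧
      (∀ (a b : EReal) (g : Icc a b → Icc a b) (Q : Set (Icc a b)) (l : ℝ),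
        (a = ⊥ ∨ b = ⊤) → IsCPMM g Q → HasConstantSlopeExt g Q l → ¬ IsConjugateTo f g) ∧
      Dynamics.coverEntropy f univ = ((Real.log lmin : ℝ) : EReal) ∧
      HasPerronValue (transitionMatrix f P) (ENNReal.ofReal lmin) ∧
      IsStronglyPositiveRecurrent (transitionMatrix f P) := by
  obtain ⟨lmin, h⟩ := exists_cubic_eq_zero
  let M := OfSlope.model h.ge
  have hM := M.transitionMatrix_submatrix
  refine ⟨lmin, fun x => cubic_eq_zero_iff h, M.map, M.partition, M.cell, OfSlope.isExampleMap h,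
    M.isCPMM, M.isTopMixing Cell.exists_forall_ge_nonempty_pathSet, fun l v hv => ?_,
    fun l => ?_, fun l hl => ?_,
    fun a b g Q l hab hg hl => M.not_isConjugateTo_of_eq_bot_or_eq_top hab hg hl, ?_, ?_, ?_⟩
  · rw [← isNonnegEigenvector_submatrix_iff M.cellEquiv, hM] at hv
    exact M.cellEquiv.summable_iff.1 (hv.hasSum_of_row_eq_one Cell.scheme_matrix_D).summable
  · rw [← exists_isNonnegEigenvector_submatrix_iff M.cellEquiv, hM]
    exact OfSlope.exists_isNonnegEigenvector_iff h
  · let N := OfSlope.model ((cubic_nonneg_iff h).2 hl)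
    exact ⟨N.map, N.partition, N.isCPMM, N.hasConstantSlope, M.isConjugateTo N⟩
  · exact OfSlope.coverEntropy_map h
  · rw [← hasPerronValue_submatrix_iff M.cellEquiv, hM]
    exact ENNReal.ofReal_coe_nnreal (p := M.slope) ▸ OfSlope.hasPerronValue h
  · rw [← isStronglyPositiveRecurrent_submatrix_iff M.cellEquiv, hM]
    exact OfSlope.isStronglyPositiveRecurrent h
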